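/- Let $n\ge 5$ and let $P$ be a convex $n$-gon with vertices labelled $1,\dots,n$ in cyclic order. A diagonal of $P$ is a pair $\{i,j\}$ of distinct vertices with $i-j\not\equiv\pm1\pmod n$. Identify every triangulation of $P$ (without additional vertices) with its set of $n-3$ pairwise noncrossing diagonals, and let $\mathcal{T}_n$ be the set of all triangulations of $P$. Let $\mathrm{KG}(\mathcal{T}_n)$ be the Kneser graph of triangulations: its vertex set is $\mathcal{T}_n$, and two triangulations are adjacent if and only if they share no diagonal. Then $\mathrm{KG}(\mathcal{T}_n)$ has a Hamiltonian cycle, that is, a cycle that visits every triangulation exactly once. -/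

import Mathlib

/-- The diagonals of a convex `n`-gon whose vertices are labelled in cyclic order by `Fin n`: the
unordered pairs of distinct vertices `i`, `j` with `i - j` not congruent to `1` or `-1`
modulo `n`. -/
def IsDiagonal (n : ℕ) (d : Sym2 (Fin n)) : Prop :=
  ∃ i j : Fin n, d = s(i, j) ∧ i ≠ j ∧
    ¬ ((i : ℤ) - (j : ℤ) ≡ 1 [ZMOD (n : ℤ)]) ∧ ¬ ((i : ℤ) - (j : ℤ) ≡ -1 [ZMOD (n : ℤ)])

/-- Two chords of a convex `n`-gon with vertices `Fin n` in cyclic order cross (in their interiors):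
their endpoints are four different vertices which alternate around the polygon. -/
def Crosses {n : ℕ} (d e : Sym2 (Fin n)) : Prop :=
  ∃ a b c x : Fin n, a < b ∧ b < c ∧ c < x ∧
    ((d = s(a, c) ∧ e = s(b, x)) ∨ (d = s(b, x) ∧ e = s(a, c)))

/-- The triangulations of a convex `n`-gon (`3 ≤ n`), each identified with its set of `n - 3`
pairwise noncrossing diagonals. -/
def triangulations (n : ℕ) : Set (Finset (Sym2 (Fin n))) :=
  {T | (∀ d ∈ T, IsDiagonal n d) ∧ (∀ d ∈ T, ∀ e ∈ T, ¬ Crosses d e) ∧ T.card = n - 3}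

/-- The Kneser graph of a family of finite sets: its vertices are the members of the family, and two
different members are adjacent when they are disjoint. -/
def kneserGraph {α : Type*} (F : Set (Finset α)) : SimpleGraph F where
  Adj A B := A ≠ B ∧ Disjoint (A : Finset α) (B : Finset α)
  symm := ⟨fun _ _ h => ⟨h.1.symm, h.2.symm⟩⟩
  loopless := ⟨fun _ h => h.1 rfl⟩

/-! Rotating the polygon by one step is an automorphism σ of the Kneser graph. A diagonal crosses
its own rotation, so T and σT share no diagonal. Hence each orbit of σ is a cycle of the graph (a
single edge if it has two elements), and the task is to merge these orbits.

Two disjoint cycles merge when an edge z–σz of one and an edge x–σx of the other satisfy z ~ x: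
these two edges are replaced by z–x and σz–σx. Orbits are merged along flips. Let T' arise from T by
a flip creating a diagonal vw at a vertex v of maximal degree in T. Then σT is disjoint from T' or T
is disjoint from σT' (`IsFlip.disjoint_or_disjoint`), so the two orbits are joined by an edge. The
flip raises the maximal degree, and one exists unless T is a fan (`exists_isFlip`,
`sameCycle_fanZero`); all fans form one orbit. The flips therefore lead every orbit to the root
orbit of the fans.

Each merge consumes an edge of the parent orbit, so that orbit needs enough edges. In T' only v and
w can have maximal degree, and T', v, w determine T (`IsFlip.unique`). If v is the only vertex of
maximal degree, T' has at most n-1 predecessors and its orbit at least n elements. If w is another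
one, there are at most 2 predecessors and at least 3 elements (`IsMaxFlip.ncard_add_one_le`). One
edge is thus left for the link to the parent. -/

/-! ### Cutting and splicing cyclic lists -/

/-- `e` joins two cyclically consecutive entries of the list `l`. -/
def List.CyclicEdge {V : Type*} (l : List V) (e : Sym2 V) : Prop :=
  ∃ u v, e = s(u, v) ∧ ([u, v] <:+: l ∨ (l.getLast? = some u ∧ l.head? = some v))

/-- Cyclically consecutive entries of the list `l` are adjacent in `G`. -/
def SimpleGraph.IsCyclicChain {V : Type*} (G : SimpleGraph V) (l : List V) : Prop :=
  l.IsChain G.Adj ∧ ∀ u v, l.getLast? = some u → l.head? = some v → G.Adj u v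

theorem List.pair_infix_append {V : Type*} {a b : V} {s t : List V} (h : [a, b] <:+: s ++ t) :
    [a, b] <:+: s ∨ [a, b] <:+: t ∨ (s.getLast? = some a ∧ t.head? = some b) := by
  induction s with
  | nil => exact Or.inr (Or.inl (by simpa using h))
  | cons x s ih =>
    rw [List.cons_append, List.infix_cons_iff] at h
    rcases h with h | h
    · rcases s with _ | ⟨y, s⟩
      · rw [List.nil_append, List.cons_prefix_cons] at h
        obtain ⟨rfl, h⟩ := h
        rcases t with _ | ⟨c, t⟩
        · simp at h
        · simp [List.cons_prefix_cons] at h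
          simp [h]
      · left
        simp only [List.cons_append, List.cons_prefix_cons] at h
        obtain ⟨rfl, rfl, -⟩ := h
        exact ⟨[], s, rfl⟩
    · rcases ih h with h | h | h
      · exact Or.inl (List.infix_cons h)
      · exact Or.inr (Or.inl h)
      · right; right
        rcases s with _ | ⟨y, s⟩
        · simp at h
        · exact ⟨by rw [List.getLast?_cons_cons]; exact h.1, h.2⟩

theorem List.pair_infix_reverse {V : Type*} {a b : V} {l : List V} :
    [a, b] <:+: l.reverse ↔ [b, a] <:+: l := by
  rw [← List.reverse_infix]
  simp

/-- Cut the cycle at one edge and, if necessary, reverse it. Every other edge survives as an inner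
edge of the resulting path. -/
theorem SimpleGraph.IsCyclicChain.exists_perm {V : Type*} {G : SimpleGraph V} {l : List V}
    (hl : G.IsCyclicChain l) {z w : V} (h : l.CyclicEdge s(z, w)) :
    ∃ L : List V, L.Perm l ∧ L.IsChain G.Adj ∧ L.head? = some w ∧ L.getLast? = some z ∧
      ∀ e, l.CyclicEdge e → e ≠ s(z, w) → ∃ u v, e = s(u, v) ∧ [u, v] <:+: L := by
  have key : ∀ u v, ([u, v] <:+: l ∨ (l.getLast? = some u ∧ l.head? = some v)) →
      ∃ L : List V, L.Perm l ∧ L.IsChain G.Adj ∧ L.head? = some v ∧ L.getLast? = some u ∧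
      ∀ e, l.CyclicEdge e → e ≠ s(u, v) → ∃ a b, e = s(a, b) ∧ [a, b] <:+: L := by
    rintro u v (⟨p, q, rfl⟩ | ⟨h1, h2⟩)
    · have hsplit : p ++ [u, v] ++ q = (p ++ [u]) ++ (v :: q) := by simp
      rw [hsplit] at hl ⊢
      refine ⟨(v :: q) ++ (p ++ [u]), List.perm_append_comm, ?_, by simp,
        by rw [List.getLast?_append_of_ne_nil _ (by simp)]; simp, ?_⟩
      · have h1 := List.isChain_append.1 hl.1
        refine List.isChain_append.2 ⟨h1.2.1, h1.1, ?_⟩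
        intro x hx y hy
        refine hl.2 x y ?_ ?_
        · rw [List.getLast?_append_of_ne_nil _ (by simp)]; exact hx
        · rw [List.head?_append_of_ne_nil _ (by simp)]; exact hy
      · rintro e ⟨a, b, rfl, h | ⟨h1, h2⟩⟩ hne
        · refine ⟨a, b, rfl, ?_⟩
          rcases List.pair_infix_append h with h | h | ⟨h1, h2⟩
          · exact List.infix_append_of_infix_right h
          · exact List.infix_append_of_infix_left h
          · simp at h1 h2
            exact absurd (by rw [h1, h2]) hne
        · refine ⟨a, b, rfl, ?_⟩
          rw [List.getLast?_append_of_ne_nil _ (by simp)] at h1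
          rw [List.head?_append_of_ne_nil _ (by simp)] at h2
          obtain ⟨A, hA⟩ := List.getLast?_eq_some_iff.1 h1
          obtain ⟨B, hB⟩ := List.head?_eq_some_iff.1 h2
          rw [hA, hB]
          exact ⟨A, B, by simp⟩
    · refine ⟨l, List.Perm.refl _, hl.1, h2, h1, ?_⟩
      rintro e ⟨a, b, rfl, h | ⟨h3, h4⟩⟩ hne
      · exact ⟨a, b, rfl, h⟩
      · rw [h1] at h3; rw [h2] at h4
        simp only [Option.some.injEq] at h3 h4
        exact absurd (by rw [h3, h4]) hne
  obtain ⟨u, v, he, h⟩ := h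
  rcases Sym2.eq_iff.1 he with ⟨rfl, rfl⟩ | ⟨rfl, rfl⟩
  · exact key _ _ h
  · obtain ⟨L, h1, h2, h3, h4, h5⟩ := key _ _ h
    refine ⟨L.reverse, (List.reverse_perm L).trans h1, ?_, by simpa using h4, by simpa using h3, ?_⟩
    · rw [List.isChain_reverse]
      exact h2.imp fun _ _ h => h.symm
    · intro e he hne
      obtain ⟨a, b, rfl, hab⟩ := h5 e he (by rwa [Sym2.eq_swap])
      exact ⟨b, a, Sym2.eq_swap, List.pair_infix_reverse.2 hab⟩

/-- Splicing: two paths close up to one cycle through two cross edges. -/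
theorem SimpleGraph.IsCyclicChain.append {V : Type*} {G : SimpleGraph V} {L M : List V}
    {z w x y : V} (hL : L.IsChain G.Adj) (hM : M.IsChain G.Adj) (hLw : L.head? = some w)
    (hLz : L.getLast? = some z) (hMx : M.head? = some x) (hMy : M.getLast? = some y)
    (hzx : G.Adj z x) (hyw : G.Adj y w) : G.IsCyclicChain (L ++ M) := by
  refine ⟨List.isChain_append.2 ⟨hL, hM, ?_⟩, ?_⟩
  · intro a ha b hb
    rw [hLz] at ha; rw [hMx] at hb
    simp only [Option.mem_def, Option.some.injEq] at ha hb
    rwa [← ha, ← hb]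
  · intro a b ha hb
    rw [List.getLast?_append, hMy] at ha
    rw [List.head?_append, hLw] at hb
    simp at ha hb
    rwa [← ha, ← hb]

/-- The orbit of `x` under `σ`, listed backwards from `x` to `σ x`. -/
theorem Equiv.Perm.exists_orbit_list {V : Type*} [Fintype V] [DecidableEq V] (σ : Equiv.Perm V)
    {x : V} (hx : σ x ≠ x) :
    ∃ M : List V, M.Nodup ∧ M.IsChain (fun a b => a = σ b) ∧ M.head? = some x ∧
      M.getLast? = some (σ x) ∧ (∀ y, y ∈ M ↔ σ.SameCycle x y) ∧
      ∀ u, σ.SameCycle x u → u ≠ x → [σ u, u] <:+: M := by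
  have hsupp : σ x ∈ σ.support := by simpa using hx
  set l := Equiv.Perm.toList σ (σ x) with hl
  have hchain : l.IsChain (fun a b => b = σ a) := by
    rw [List.isChain_iff_getElem]
    intro i hi
    simp only [hl, Equiv.Perm.getElem_toList, pow_succ', Equiv.Perm.mul_apply]
  have hpos : 0 < l.length := Equiv.Perm.length_toList_pos_of_mem_support σ _ hsupp
  have hmem : ∀ y, y ∈ l ↔ σ.SameCycle x y := fun y => by
    rw [hl, Equiv.Perm.mem_toList_iff, Equiv.Perm.sameCycle_apply_left]
    exact and_iff_left hsupp
  have hhead : l.head? = some (σ x) := by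
    rw [List.head?_eq_getElem?, List.getElem?_eq_getElem hpos]
    simp [hl, Equiv.Perm.toList_getElem_zero σ _ hsupp]
  have hnd : l.Nodup := Equiv.Perm.nodup_toList σ (σ x)
  have hnext : ∀ u, u ∈ l → l.getLast? ≠ some u → [u, σ u] <:+: l := by
    intro u hu hne
    obtain ⟨p, q, hpq⟩ := List.append_of_mem hu
    rcases q with _ | ⟨w, q⟩
    · exact absurd (by simp [hpq]) hne
    · rw [hpq] at hchain ⊢
      have := (List.isChain_append_cons_cons.1 hchain).2.1
      exact ⟨p, q, by simp [this]⟩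
  have hlast : l.getLast? = some x := by
    by_contra hne
    obtain ⟨p, q, hpq⟩ := hnext x ((hmem x).2 (Equiv.Perm.SameCycle.refl _ _)) hne
    obtain ⟨t, ht⟩ := List.head?_eq_some_iff.1 hhead
    rcases p with _ | ⟨c, p⟩
    · rw [← hpq] at hhead
      simp at hhead
      exact hx hhead.symm
    · have : σ x ∈ t := by
        have := hpq.trans ht
        simp only [List.cons_append, List.cons.injEq] at this
        rw [← this.2]; simp
      rw [ht] at hnd
      exact (List.nodup_cons.1 hnd).1 this
  refine ⟨l.reverse, by simpa using hnd, by rwa [List.isChain_reverse], by simpa using hlast,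
    by simpa using hhead, by simpa using hmem, ?_⟩
  intro u hu hne
  rw [List.pair_infix_reverse]
  refine hnext u ((hmem u).2 hu) ?_
  rw [hlast]
  simpa using hne.symm

theorem SimpleGraph.IsCyclicChain.exists_isHamiltonianCycle {V : Type*} [DecidableEq V]
    {G : SimpleGraph V} {l : List V} (hl : G.IsCyclicChain l) (hnd : l.Nodup)
    (hall : ∀ x, x ∈ l) (hlen : 3 ≤ l.length) :
    ∃ (x : V) (p : G.Walk x x), p.IsHamiltonianCycle := by
  have hne : l ≠ [] := by rintro rfl; simp at hlen
  let p := Walk.ofSupport l hne hl.1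
  have hsup : p.support = l := Walk.support_ofSupport hne hl.1
  have hadj : G.Adj (l.getLast hne) (l.head hne) :=
    hl.2 _ _ (List.getLast?_eq_some_getLast hne) (List.head?_eq_some_head hne)
  have hp : p.IsPath := Walk.IsPath.mk' (by rw [hsup]; exact hnd)
  refine ⟨_, Walk.cons hadj p, ?_⟩
  have hplen : p.length + 1 = l.length := by rw [← Walk.length_support, hsup]
  refine ⟨(Walk.cons_isCycle_iff _ _).2 ⟨hp, ?_⟩, ?_⟩
  · intro hmem
    have := hp.length_eq_one_of_mem_edges (by rwa [Sym2.eq_swap])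
    omega
  · have := hp.isHamiltonian_of_mem (by rw [hsup]; exact hall)
    intro a
    simpa using this a

/-! ### Merging the orbits of an automorphism into a Hamiltonian cycle -/

/-- `P x y` says that the orbit of `x` may be hung below that of `y`. As `P` is σ-invariant, every
child orbit has a member among the `x` with `P x y`, so `hcard` provides an edge for each child and
one for the parent. -/
theorem SimpleGraph.exists_isHamiltonianCycle_of_orbits {V : Type*} [Fintype V] [DecidableEq V]
    (G : SimpleGraph V) (σ : Equiv.Perm V) (hadj : ∀ x, G.Adj x (σ x))
    (hiso : ∀ x y, G.Adj x y → G.Adj (σ x) (σ y))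
    (P : V → V → Prop) (hP : ∀ x y, P x y → P (σ x) (σ y))
    (hglue : ∀ x y, P x y → ∃ x' y', σ.SameCycle x x' ∧ σ.SameCycle y y' ∧ G.Adj x' y')
    (rank : V → ℕ) (hrank : ∀ x y, P x y → rank x < rank y)
    (r : V) (hr : σ (σ r) ≠ r) (hroot : ∀ x, ¬ σ.SameCycle r x → ∃ y, P x y)
    (h2 : ∀ x y, P x y → σ (σ y) ≠ y)
    (hcard : ∀ x y, P x y →
      {x | P x y}.ncard + 1 ≤ {z | σ.SameCycle y z}.ncard) :
    ∃ (x : V) (p : G.Walk x x), p.IsHamiltonianCycle := by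
  classical
  have hadjk : ∀ (k : ℕ) x y, G.Adj x y → G.Adj ((σ ^ k) x) ((σ ^ k) y) := by
    intro k
    induction k with
    | zero => simp
    | succ k ih => intro x y h; simpa [pow_succ'] using hiso _ _ (ih x y h)
  have hPk : ∀ (k : ℕ) x y, P x y → P ((σ ^ k) x) ((σ ^ k) y) := by
    intro k
    induction k with
    | zero => simp
    | succ k ih => intro x y h; simpa [pow_succ'] using hP _ _ (ih x y h)
  -- The edges `u`–`σ u` are distinct for distinct `u`, except in an orbit of size two.
  have hedge : ∀ u z, s(u, σ u) = s(z, σ z) → u = z ∨ (u = σ z ∧ σ (σ z) = z) := by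
    intro u z h
    rcases Sym2.eq_iff.1 h with ⟨h, -⟩ | ⟨h, h'⟩
    · exact Or.inl h
    · exact Or.inr ⟨h, by rw [← h, h']⟩
  -- The invariant: a cycle through a union of orbits containing `r`, in which an orbit has lost at
  -- most one edge to its parent and one for each child already absorbed.
  let Inv : List V → Prop := fun l => l.Nodup ∧ G.IsCyclicChain l ∧
    (∀ x ∈ l, ∀ y, σ.SameCycle x y → y ∈ l) ∧ r ∈ l ∧
    ∀ y ∈ l, (∃ x, P x y) → {z | σ.SameCycle y z ∧ ¬ l.CyclicEdge s(z, σ z)}.ncard ≤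
      1 + {x | P x y ∧ x ∈ l}.ncard
  have hbase : ∃ l, Inv l := by
    obtain ⟨M, hM1, hM2, hM3, hM4, hM5, hM6⟩ := σ.exists_orbit_list (hadj r).ne'
    refine ⟨M, hM1, ⟨hM2.imp (by rintro a b rfl; exact (hadj b).symm), ?_⟩, ?_,
      (hM5 r).2 (Equiv.Perm.SameCycle.refl _ _), ?_⟩
    · intro u v hu hv
      rw [hM4] at hu; rw [hM3] at hv
      simp only [Option.some.injEq] at hu hv
      rw [← hu, ← hv]
      exact (hadj r).symm
    · intro x hx y hxy
      exact (hM5 y).2 (((hM5 x).1 hx).trans hxy)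
    · intro y hy _
      have : {z | σ.SameCycle y z ∧ ¬ M.CyclicEdge s(z, σ z)} ⊆ {r} := by
        rintro z ⟨hz, hne⟩
        by_contra hzr
        exact hne ⟨σ z, z, Sym2.eq_swap, Or.inl (hM6 z (((hM5 y).1 hy).trans hz) hzr)⟩
      have := Set.ncard_le_ncard this
      rw [Set.ncard_singleton] at this
      omega
  have hstep : ∀ l, Inv l → (∃ x, x ∉ l) → ∃ l', Inv l' ∧ l.length < l'.length := by
    rintro l ⟨hnd, hcyc, hclosed, hrl, hcount⟩ hex
    -- Maximal rank among the missing vertices forces the parent of `x` to be present.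
    obtain ⟨x, hx, hmax⟩ := (Finset.univ.filter (· ∉ l)).exists_max_image rank
      (by obtain ⟨x, hx⟩ := hex; exact ⟨x, by simpa using hx⟩)
    simp only [Finset.mem_filter, Finset.mem_univ, true_and] at hx hmax
    obtain ⟨y, hxy⟩ := hroot x fun h => hx (hclosed r hrl x h)
    have hy : y ∈ l := by
      by_contra hy
      exact absurd (hmax y hy) (not_le.2 (hrank x y hxy))
    -- Some orbit edge at `y` is still unused: `x` is a child not yet absorbed, so the lost edges
    -- are fewer than `hcard` allows.
    obtain ⟨z, hyz, hz⟩ : ∃ z, σ.SameCycle y z ∧ l.CyclicEdge s(z, σ z) := by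
      by_contra hno
      push Not at hno
      have h1 := hcount y hy ⟨x, hxy⟩
      have h3 : {z | σ.SameCycle y z ∧ ¬ l.CyclicEdge s(z, σ z)} = {z | σ.SameCycle y z} := by
        ext z
        exact ⟨fun h => h.1, fun h => ⟨h, hno z h⟩⟩
      have h4 : {x | P x y ∧ x ∈ l}.ncard < {x | P x y}.ncard := by
        refine Set.ncard_lt_ncard ⟨fun x h => h.1, fun h => hx (h hxy).2⟩
      have := hcard x y hxy
      rw [h3] at h1
      omega
    obtain ⟨x₁, y₁, hx₁, hy₁, hxy₁⟩ := hglue x y hxy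
    -- A power of σ moves the cross edge so that it ends at the unused edge.
    obtain ⟨k, rfl⟩ := (hy₁.symm.trans hyz).exists_nat_pow_eq
    set z := (σ ^ k) y₁ with hzdef
    set x' := (σ ^ k) x₁ with hx'def
    have hxx' : σ.SameCycle x x' := by
      rw [hx'def, Equiv.Perm.sameCycle_pow_right]; exact hx₁
    have hzx : G.Adj z x' := (hadjk k _ _ hxy₁).symm
    obtain ⟨M, hM1, hM2, hM3, hM4, hM5, hM6⟩ := σ.exists_orbit_list (hadj x').ne'
    obtain ⟨L, hL1, hL2, hL3, hL4, hL5⟩ := hcyc.exists_perm hz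
    have hMl : ∀ u ∈ M, u ∉ l := fun u hu hul =>
      hx (hclosed u hul x ((hxx'.trans ((hM5 u).1 hu)).symm))
    have hL5' : ∀ u, l.CyclicEdge s(u, σ u) → s(u, σ u) ≠ s(z, σ z) →
        (L ++ M).CyclicEdge s(u, σ u) := by
      intro u hu hne
      obtain ⟨a, b, hab, h⟩ := hL5 _ hu hne
      exact ⟨a, b, hab, Or.inl (List.infix_append_of_infix_left h)⟩
    have hmemL : ∀ u, u ∈ L ↔ u ∈ l := fun u => hL1.mem_iff
    refine ⟨L ++ M, ⟨?_, ?_, ?_, ?_, ?_⟩, ?_⟩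
    · rw [List.nodup_append]
      refine ⟨hL1.nodup_iff.2 hnd, hM1, ?_⟩
      rintro a ha b hb rfl
      exact hMl a hb ((hmemL a).1 ha)
    · exact SimpleGraph.IsCyclicChain.append hL2 (hM2.imp (by rintro a b rfl; exact (hadj b).symm))
        hL3 hL4 hM3 hM4 hzx (hiso _ _ hzx.symm)
    · intro u hu v huv
      rw [List.mem_append, hmemL] at hu ⊢
      rcases hu with hu | hu
      · exact Or.inl (hclosed u hu v huv)
      · exact Or.inr ((hM5 v).2 (((hM5 u).1 hu).trans huv))
    · rw [List.mem_append, hmemL]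
      exact Or.inl hrl
    · intro u hu hPu
      rw [List.mem_append, hmemL] at hu
      rcases hu with hu | hu
      · have h1 := hcount u hu hPu
        have hsub : {x | P x u ∧ x ∈ l} ⊆ {x | P x u ∧ x ∈ L ++ M} := fun v hv =>
          ⟨hv.1, List.mem_append_left _ ((hmemL v).2 hv.2)⟩
        by_cases huz : σ.SameCycle u z
        · have h3 : {v | σ.SameCycle u v ∧ ¬ (L ++ M).CyclicEdge s(v, σ v)} ⊆
              insert z {v | σ.SameCycle u v ∧ ¬ l.CyclicEdge s(v, σ v)} := by
            rintro v ⟨huv, hv⟩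
            by_cases hvz : v = z
            · exact Or.inl hvz
            · refine Or.inr ⟨huv, fun hvl => hv (hL5' v hvl fun he => ?_)⟩
              rcases hedge _ _ he with h | ⟨h, h'⟩
              · exact hvz h
              · obtain ⟨w, hw⟩ := hPu
                obtain ⟨j, hj⟩ := huz.symm.exists_nat_pow_eq
                refine h2 w u hw ?_
                have hcomm : ∀ w, σ ((σ ^ j) w) = (σ ^ j) (σ w) := fun w => by
                  rw [← Equiv.Perm.mul_apply, ← Equiv.Perm.mul_apply, ← pow_succ', pow_succ]
                rw [← hj, hcomm, hcomm, h']
          -- The lost edge at `z` is paid for by the newly absorbed child: the power of σ taking `y`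
          -- to `u` takes `x` to a child of `u` in `M`.
          have h4 : {x | P x u ∧ x ∈ l}.ncard < {x | P x u ∧ x ∈ L ++ M}.ncard := by
            refine Set.ncard_lt_ncard ⟨hsub, fun h => ?_⟩
            obtain ⟨j, hj⟩ := (hyz.trans huz.symm).exists_nat_pow_eq
            have hPj := hPk j x y hxy
            rw [hj] at hPj
            have hxj : σ.SameCycle x ((σ ^ j) x) :=
              Equiv.Perm.sameCycle_pow_right.2 (Equiv.Perm.SameCycle.refl _ _)
            have := (h ⟨hPj, List.mem_append_right _ ((hM5 _).2 (hxx'.symm.trans hxj))⟩).2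
            exact hx (hclosed _ this x hxj.symm)
          have h5 := Set.ncard_le_ncard h3
          have h6 := Set.ncard_insert_le z {v | σ.SameCycle u v ∧ ¬ l.CyclicEdge s(v, σ v)}
          omega
        · have h3 : {v | σ.SameCycle u v ∧ ¬ (L ++ M).CyclicEdge s(v, σ v)} ⊆
              {v | σ.SameCycle u v ∧ ¬ l.CyclicEdge s(v, σ v)} := by
            rintro v ⟨huv, hv⟩
            refine ⟨huv, fun hvl => hv (hL5' v hvl fun he => huz ?_)⟩
            rcases hedge _ _ he with h | ⟨h, -⟩
            · exact h ▸ huv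
            · rw [h, Equiv.Perm.sameCycle_apply_right] at huv
              exact huv
          have := Set.ncard_le_ncard h3
          have := Set.ncard_le_ncard hsub
          omega
      · have : {v | σ.SameCycle u v ∧ ¬ (L ++ M).CyclicEdge s(v, σ v)} ⊆ {x'} := by
          rintro v ⟨huv, hne⟩
          by_contra hvx
          exact hne ⟨σ v, v, Sym2.eq_swap, Or.inl (List.infix_append_of_infix_right
            (hM6 v (((hM5 u).1 hu).trans huv) hvx))⟩
        have := Set.ncard_le_ncard this
        rw [Set.ncard_singleton] at this
        omega
    · have hMpos : 0 < M.length := List.length_pos_of_mem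
        ((hM5 x').2 (Equiv.Perm.SameCycle.refl _ _))
      rw [List.length_append, hL1.length_eq]
      omega
  have hfull : ∀ k l, Inv l → Fintype.card V - l.length ≤ k → ∃ l', Inv l' ∧ ∀ x, x ∈ l' := by
    intro k
    induction k with
    | zero =>
      intro l hl hk
      by_contra hno
      push Not at hno
      obtain ⟨l', hl', hlt⟩ := hstep l hl (hno l hl)
      have := hl'.1.length_le_card
      omega
    | succ k ih =>
      intro l hl hk
      by_cases hex : ∃ x, x ∉ l
      · obtain ⟨l', hl', hlt⟩ := hstep l hl hex
        exact ih l' hl' (by omega)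
      · push Not at hex
        exact ⟨l, hl, hex⟩
  obtain ⟨l₀, hl₀⟩ := hbase
  obtain ⟨l, hl, hall⟩ := hfull _ l₀ hl₀ le_rfl
  refine hl.2.1.exists_isHamiltonianCycle hl.1 hall ?_
  have h3 : [r, σ r, σ (σ r)].Nodup := by
    simp only [List.nodup_cons, List.mem_cons, List.not_mem_nil, or_false, not_or]
    exact ⟨⟨(hadj r).ne, hr.symm⟩, (hadj (σ r)).ne, not_false, List.nodup_nil⟩
  exact (List.subperm_of_subset h3 fun x _ => hall x).length_le

/-! ### Chords, crossings and the rotation of the polygon -/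

section Rotation

variable {n : ℕ}

theorem not_isDiagonal_mk_self (i : Fin n) : ¬ IsDiagonal n s(i, i) := by
  rintro ⟨a, b, hab, hne, -⟩
  rcases Sym2.eq_iff.1 hab with ⟨rfl, rfl⟩ | ⟨rfl, rfl⟩ <;> exact hne rfl

theorem Crosses.symm {d e : Sym2 (Fin n)} (h : Crosses d e) : Crosses e d := by
  obtain ⟨a, b, c, x, h1, h2, h3, h | h⟩ := h
  · exact ⟨a, b, c, x, h1, h2, h3, Or.inr ⟨h.2, h.1⟩⟩
  · exact ⟨a, b, c, x, h1, h2, h3, Or.inl ⟨h.2, h.1⟩⟩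

theorem Sym2.mk_eq_mk_iff_of_lt {i j k l : Fin n} (h : i < j) (h' : k < l) :
    s(i, j) = s(k, l) ↔ i = k ∧ j = l := by
  refine ⟨fun he => ?_, fun ⟨h1, h2⟩ => by rw [h1, h2]⟩
  rcases Sym2.eq_iff.1 he with h1 | ⟨rfl, rfl⟩
  · exact h1
  · exact absurd h (lt_asymm h')

theorem Crosses.of_cyclic {a b c x : Fin n} (h : a < b) (h' : b < c) (h'' : c < x) :
    Crosses s(a, c) s(b, x) :=
  ⟨a, b, c, x, h, h', h'', Or.inl ⟨rfl, rfl⟩⟩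

/-- The last vertex `c` before `j` which is joined to `i` by a chord of `T` or by the side of the
polygon leaving `i`. -/
theorem exists_apex (T : Finset (Sym2 (Fin n))) {i j : Fin n} (h : (i : ℕ) + 2 ≤ j) :
    ∃ c : Fin n, i < c ∧ c < j ∧ ((c : ℕ) = i + 1 ∨ s(i, c) ∈ T) ∧
      ∀ c', c < c' → c' < j → s(i, c') ∉ T := by
  classical
  let S := Finset.univ.filter fun c : Fin n =>
    i < c ∧ c < j ∧ ((c : ℕ) = i + 1 ∨ s(i, c) ∈ T)
  have hS : S.Nonempty := by
    refine ⟨⟨(i : ℕ) + 1, by omega⟩, ?_⟩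
    simp only [S, Finset.mem_filter, Finset.mem_univ, true_and, Fin.lt_def]
    exact ⟨by omega, by omega, Or.inl trivial⟩
  have hmem := S.max'_mem hS
  simp only [S, Finset.mem_filter, Finset.mem_univ, true_and] at hmem
  refine ⟨S.max' hS, hmem.1, hmem.2.1, hmem.2.2, fun c' h1 h2 h3 => ?_⟩
  refine absurd (S.le_max' c' ?_) (not_le.2 h1)
  simp only [S, Finset.mem_filter, Finset.mem_univ, true_and]
  exact ⟨hmem.1.trans h1, h2, Or.inr h3⟩

theorem IsDiagonal.exists_lt {d : Sym2 (Fin n)} (hd : IsDiagonal n d) :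
    ∃ i j : Fin n, i < j ∧ d = s(i, j) := by
  induction d with
  | _ i j =>
    rcases lt_trichotomy i j with h | rfl | h
    · exact ⟨i, j, h, rfl⟩
    · exact absurd hd (not_isDiagonal_mk_self i)
    · exact ⟨j, i, h, Sym2.eq_swap⟩

theorem crosses_mk_iff {i j k l : Fin n} (h : i < j) (h' : k < l) :
    Crosses s(i, j) s(k, l) ↔ (i < k ∧ k < j ∧ j < l) ∨ (k < i ∧ i < l ∧ l < j) := by
  constructor
  · rintro ⟨a, b, c, x, h1, h2, h3, ⟨h4, h5⟩ | ⟨h4, h5⟩⟩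
    · obtain ⟨rfl, rfl⟩ := (Sym2.mk_eq_mk_iff_of_lt h (h1.trans h2)).1 h4
      obtain ⟨rfl, rfl⟩ := (Sym2.mk_eq_mk_iff_of_lt h' (h2.trans h3)).1 h5
      exact Or.inl ⟨h1, h2, h3⟩
    · obtain ⟨rfl, rfl⟩ := (Sym2.mk_eq_mk_iff_of_lt h (h2.trans h3)).1 h4
      obtain ⟨rfl, rfl⟩ := (Sym2.mk_eq_mk_iff_of_lt h' (h1.trans h2)).1 h5
      exact Or.inr ⟨h1, h2, h3⟩
  · rintro (⟨h1, h2, h3⟩ | ⟨h1, h2, h3⟩)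
    · exact ⟨i, k, j, l, h1, h2, h3, Or.inl ⟨rfl, rfl⟩⟩
    · exact ⟨k, i, l, j, h1, h2, h3, Or.inr ⟨rfl, rfl⟩⟩

/-- A chord `ij` is sent to the apex of the triangle below it. Two noncrossing chords with the same
apex have the same left end, since otherwise the side from the outer left end to the apex crosses
the other chord; by the choice of the apex they then have the same right end. The apex is neither 0
nor n-1, which leaves n-2 values. -/
theorem card_le_of_noncrossing_chords {T : Finset (Sym2 (Fin n))}
    (hT : ∀ d ∈ T, ∃ i j : Fin n, d = s(i, j) ∧ (i : ℕ) + 2 ≤ j)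
    (hc : ∀ d ∈ T, ∀ e ∈ T, ¬ Crosses d e) : T.card ≤ n - 2 := by
  have key : ∀ d : T, ∃ c i j : Fin n, (d : Sym2 (Fin n)) = s(i, j) ∧ i < c ∧ c < j ∧
      ((c : ℕ) = i + 1 ∨ s(i, c) ∈ T) ∧ ∀ c', c < c' → c' < j → s(i, c') ∉ T := by
    rintro ⟨d, hd⟩
    obtain ⟨i, j, rfl, h⟩ := hT d hd
    obtain ⟨c, hc⟩ := exists_apex T h
    exact ⟨c, i, j, rfl, hc⟩
  choose f i j hd hif hfj hor hmax using key
  have hnot : ∀ d e : T, f d = f e → ¬ i d < i e := by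
    intro d e he hlt
    have h1 := hif e
    have h2 := hfj e
    rw [← he] at h1 h2
    rcases hor d with h | h
    · rw [Fin.lt_def] at hlt h1
      omega
    · refine hc _ h _ e.2 ?_
      rw [hd e]
      exact Crosses.of_cyclic hlt h1 h2
  have hnot' : ∀ d e : T, f d = f e → i d = i e → ¬ j d < j e := by
    intro d e he hie hlt
    refine hmax e (j d) (he ▸ hfj d) hlt ?_
    rw [← hie, ← hd d]
    exact d.2
  have hinj : Function.Injective f := by
    intro d e he
    have hi : i d = i e := le_antisymm (not_lt.1 (hnot e d he.symm)) (not_lt.1 (hnot d e he))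
    have hj : j d = j e := le_antisymm (not_lt.1 (hnot' e d he.symm hi.symm))
      (not_lt.1 (hnot' d e he hi))
    exact Subtype.ext (by rw [hd d, hd e, hi, hj])
  have hcard : T.attach.card ≤ (Finset.Ioo 0 (n - 1)).card := by
    refine Finset.card_le_card_of_injOn (fun d => (f d : ℕ)) ?_ ?_
    · intro d _
      have h1 := hif d
      have h2 := hfj d
      have h3 := (j d).2
      rw [Fin.lt_def] at h1 h2
      simp only [Finset.coe_Ioo, Set.mem_Ioo]
      omega
    · intro d _ e _ h
      exact hinj (Fin.ext h)
  rw [Finset.card_attach, Nat.card_Ioo] at hcard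
  omega

variable [NeZero n]

theorem Fin.val_add_one_eq_ite (hn : 2 ≤ n) (v : Fin n) :
    ((v + 1 : Fin n) : ℕ) = if (v : ℕ) + 1 = n then 0 else (v : ℕ) + 1 := by
  rw [Fin.val_add, Fin.val_one', Nat.mod_eq_of_lt (by omega : 1 < n)]
  split_ifs with h
  · rw [h, Nat.mod_self]
  · exact Nat.mod_eq_of_lt (by omega)

theorem Fin.val_iterate_add_one (v : Fin n) (k : ℕ) :
    (((· + 1)^[k] v : Fin n) : ℕ) = ((v : ℕ) + k) % n := by
  induction k with
  | zero => simp [Nat.mod_eq_of_lt v.2]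
  | succ k ih =>
    rw [Function.iterate_succ_apply', Fin.val_add, ih, Fin.val_one', ← Nat.add_mod, Nat.add_assoc]

/-- Reduces statements about a vertex to the vertex 0, where the cyclic order is the linear order of
`Fin n`: the step is one rotation. -/
theorem Fin.cyclic_induction (hn : 2 ≤ n) {p : Fin n → Prop} (h0 : p 0)
    (hs : ∀ v, p (v + 1) → p v) (v : Fin n) : p v := by
  have key : ∀ k, ∀ v : Fin n, n - v.val = k + 1 → p v := by
    intro k
    induction k with
    | zero =>
      intro v hv
      refine hs v ?_
      have : v + 1 = 0 := by
        ext
        rw [Fin.val_add_one_eq_ite hn, if_pos (by omega), Fin.val_zero]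
      rwa [this]
    | succ k ih =>
      intro v hv
      refine hs v (ih _ ?_)
      rw [Fin.val_add_one_eq_ite hn, if_neg (by omega)]
      omega
  exact key (n - v.val - 1) v (by omega)

theorem isDiagonal_mk_iff {i j : Fin n} (h : i < j) :
    IsDiagonal n s(i, j) ↔ (i : ℕ) + 2 ≤ j ∧ ¬ ((i : ℕ) = 0 ∧ (j : ℕ) + 1 = n) := by
  have hdvd : ∀ t : ℤ, (n : ℤ) ∣ t → -(2 * n : ℤ) < t → t < 2 * n → t = -n ∨ t = 0 ∨ t = n := by
    rintro t ⟨k, rfl⟩ h1 h2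
    have hn : (0 : ℤ) < n := by have := NeZero.pos n; omega
    have : -2 < k := by nlinarith
    have : k < 2 := by nlinarith
    have : k = -1 ∨ k = 0 ∨ k = 1 := by omega
    rcases this with rfl | rfl | rfl <;> simp
  have hlt : (i : ℕ) < j := h
  have hj := j.2
  constructor
  · rintro ⟨a, b, hab, hne, h1, h2⟩
    rw [Int.modEq_iff_dvd] at h1 h2
    constructor
    · by_contra hc
      have : (j : ℕ) = i + 1 := by omega
      rcases Sym2.eq_iff.1 hab with ⟨rfl, rfl⟩ | ⟨rfl, rfl⟩
      · exact h2 ⟨0, by push_cast [this]; ring⟩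
      · exact h1 ⟨0, by push_cast [this]; ring⟩
    · rintro ⟨hi, hj⟩
      have hn : (n : ℤ) = j + 1 := by omega
      rcases Sym2.eq_iff.1 hab with ⟨rfl, rfl⟩ | ⟨rfl, rfl⟩
      · exact h1 ⟨1, by rw [hi, hn]; push_cast; ring⟩
      · exact h2 ⟨-1, by rw [hi, hn]; push_cast; ring⟩
  · rintro ⟨h1, h2⟩
    refine ⟨i, j, rfl, h.ne, fun hc => ?_, fun hc => ?_⟩
    · rw [Int.modEq_iff_dvd] at hc
      have := hdvd _ hc (by omega) (by omega)
      omega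
    · rw [Int.modEq_iff_dvd] at hc
      have := hdvd _ hc (by omega) (by omega)
      omega

/-- The rotation of the `n`-gon by one step, acting on chords. -/
def rotateChord (d : Sym2 (Fin n)) : Sym2 (Fin n) := d.map (· + 1)

theorem rotateChord_mk (i j : Fin n) : rotateChord s(i, j) = s(i + 1, j + 1) := rfl

theorem rotateChord_injective : Function.Injective (rotateChord (n := n)) :=
  Sym2.map.injective (add_left_injective 1)

theorem isDiagonal_rotateChord (hn : 2 ≤ n) {d : Sym2 (Fin n)} :
    IsDiagonal n (rotateChord d) ↔ IsDiagonal n d := by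
  have key : ∀ i j : Fin n, i < j → (IsDiagonal n s(i + 1, j + 1) ↔ IsDiagonal n s(i, j)) := by
    intro i j h
    have hlt : (i : ℕ) < j := h
    have hi := Fin.val_add_one_eq_ite hn i
    have hj := Fin.val_add_one_eq_ite hn j
    have := j.2
    rw [if_neg (by omega)] at hi
    rw [isDiagonal_mk_iff h]
    by_cases hc : (j : ℕ) + 1 = n
    · rw [if_pos hc] at hj
      rw [Sym2.eq_swap, isDiagonal_mk_iff (by rw [Fin.lt_def]; omega)]
      omega
    · rw [if_neg hc] at hj
      rw [isDiagonal_mk_iff (by rw [Fin.lt_def]; omega)]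
      omega
  induction d with
  | _ i j =>
    rw [rotateChord_mk]
    rcases lt_trichotomy i j with h | rfl | h
    · exact key i j h
    · exact iff_of_false (not_isDiagonal_mk_self _) (not_isDiagonal_mk_self _)
    · rw [Sym2.eq_swap, key j i h, Sym2.eq_swap]

theorem crosses_rotateChord (hn : 2 ≤ n) {d e : Sym2 (Fin n)} :
    Crosses (rotateChord d) (rotateChord e) ↔ Crosses d e := by
  have fwd : ∀ a b c x : Fin n, a < b → b < c → c < x →
      Crosses s(a + 1, c + 1) s(b + 1, x + 1) := by
    intro a b c x h1 h2 h3
    have ha := Fin.val_add_one_eq_ite hn a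
    have hb := Fin.val_add_one_eq_ite hn b
    have hc := Fin.val_add_one_eq_ite hn c
    have hx := Fin.val_add_one_eq_ite hn x
    rw [Fin.lt_def] at h1 h2 h3
    -- Only the largest endpoint can wrap around to 0; the two chords then exchange roles.
    have := x.2
    rw [if_neg (by omega)] at ha hb hc
    by_cases hlast : (x : ℕ) + 1 = n
    · rw [if_pos hlast] at hx
      rw [Sym2.eq_swap (a := b + 1)]
      refine (Crosses.of_cyclic ?_ ?_ ?_).symm <;> rw [Fin.lt_def] <;> omega
    · rw [if_neg hlast] at hx
      refine Crosses.of_cyclic ?_ ?_ ?_ <;> rw [Fin.lt_def] <;> omega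
  have bwd : ∀ a b c x : Fin n, a + 1 < b + 1 → b + 1 < c + 1 → c + 1 < x + 1 →
      Crosses s(a, c) s(b, x) := by
    intro a b c x h1 h2 h3
    have ha := Fin.val_add_one_eq_ite hn a
    have hb := Fin.val_add_one_eq_ite hn b
    have hc := Fin.val_add_one_eq_ite hn c
    have hx := Fin.val_add_one_eq_ite hn x
    have := a.2
    have := b.2
    have := c.2
    have := x.2
    rw [Fin.lt_def] at h1 h2 h3
    have hb' : (b : ℕ) + 1 ≠ n := fun h => by rw [if_pos h] at hb; omega
    rw [if_neg hb'] at hb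
    have hc' : (c : ℕ) + 1 ≠ n := fun h => by rw [if_pos h] at hc; omega
    rw [if_neg hc'] at hc
    have hx' : (x : ℕ) + 1 ≠ n := fun h => by rw [if_pos h] at hx; omega
    rw [if_neg hx'] at hx
    by_cases hlast : (a : ℕ) + 1 = n
    · rw [if_pos hlast] at ha
      rw [Sym2.eq_swap (a := a)]
      refine (Crosses.of_cyclic ?_ ?_ ?_).symm <;> rw [Fin.lt_def] <;> omega
    · rw [if_neg hlast] at ha
      refine Crosses.of_cyclic ?_ ?_ ?_ <;> rw [Fin.lt_def] <;> omega
  constructor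
  · rintro ⟨a, b, c, x, h1, h2, h3, h⟩
    obtain ⟨a, rfl⟩ := (Equiv.addRight (1 : Fin n)).surjective a
    obtain ⟨b, rfl⟩ := (Equiv.addRight (1 : Fin n)).surjective b
    obtain ⟨c, rfl⟩ := (Equiv.addRight (1 : Fin n)).surjective c
    obtain ⟨x, rfl⟩ := (Equiv.addRight (1 : Fin n)).surjective x
    simp only [Equiv.coe_addRight] at h1 h2 h3 h
    have := bwd a b c x h1 h2 h3
    rw [← rotateChord_mk, ← rotateChord_mk, rotateChord_injective.eq_iff,
      rotateChord_injective.eq_iff, rotateChord_injective.eq_iff, rotateChord_injective.eq_iff] at h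
    rcases h with ⟨rfl, rfl⟩ | ⟨rfl, rfl⟩
    · exact this
    · exact this.symm
  · rintro ⟨a, b, c, x, h1, h2, h3, ⟨rfl, rfl⟩ | ⟨rfl, rfl⟩⟩
    · exact fwd a b c x h1 h2 h3
    · exact (fwd a b c x h1 h2 h3).symm

/-- A diagonal skips a vertex on either side, so `i`, `i + 1`, `j`, `j + 1` are distinct and
alternate. -/
theorem IsDiagonal.crosses_rotateChord (hn : 2 ≤ n) {d : Sym2 (Fin n)} (hd : IsDiagonal n d) :
    Crosses d (rotateChord d) := by
  obtain ⟨i, j, h, rfl⟩ := hd.exists_lt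
  rw [isDiagonal_mk_iff h] at hd
  rw [rotateChord_mk]
  have hi := Fin.val_add_one_eq_ite hn i
  have hj := Fin.val_add_one_eq_ite hn j
  rw [Fin.lt_def] at h
  have := j.2
  rw [if_neg (by omega)] at hi
  by_cases hc : (j : ℕ) + 1 = n
  · rw [if_pos hc] at hj
    rw [Sym2.eq_swap (a := i + 1)]
    refine (Crosses.of_cyclic ?_ ?_ ?_).symm <;> rw [Fin.lt_def] <;> omega
  · rw [if_neg hc] at hj
    refine Crosses.of_cyclic ?_ ?_ ?_ <;> rw [Fin.lt_def] <;> omega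

/-- Fixing or exchanging the endpoints would make n divide 2 or 4. -/
theorem rotateChord_rotateChord_ne (hn : 5 ≤ n) {d : Sym2 (Fin n)} (hd : IsDiagonal n d) :
    rotateChord (rotateChord d) ≠ d := by
  obtain ⟨i, j, h, rfl⟩ := hd.exists_lt
  intro he
  have h2 : 2 ≤ n := by omega
  have hi := Fin.val_add_one_eq_ite h2 i
  have hj := Fin.val_add_one_eq_ite h2 j
  have hi' := Fin.val_add_one_eq_ite h2 (i + 1)
  have hj' := Fin.val_add_one_eq_ite h2 (j + 1)
  rw [Fin.lt_def] at h
  have := j.2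
  rw [rotateChord_mk, rotateChord_mk, Sym2.eq_iff, Fin.ext_iff, Fin.ext_iff, Fin.ext_iff,
    Fin.ext_iff, hi', hj', hi, hj] at he
  split_ifs at he <;> omega

end Rotation

/-! ### Flips, studied at the vertex 0 -/

section Noncrossing

variable {n : ℕ}

theorem mem_triangulations_of_flip (hn : 3 ≤ n) {T : Finset (Sym2 (Fin n))} {d e : Sym2 (Fin n)}
    (hT : T ∈ triangulations n) (hd : d ∈ T) (he : e ∉ T) (hed : IsDiagonal n e)
    (hne : ∀ f ∈ T, f ≠ d → ¬ Crosses e f) : insert e (T.erase d) ∈ triangulations n := by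
  refine ⟨?_, ?_, ?_⟩
  · intro f hf
    rcases Finset.mem_insert.1 hf with rfl | hf
    · exact hed
    · exact hT.1 f (Finset.mem_of_mem_erase hf)
  · have hee : ¬ Crosses e e := by
      obtain ⟨i, j, h, rfl⟩ := hed.exists_lt
      rw [crosses_mk_iff h h]
      simp
    intro f hf g hg hfg
    rcases Finset.mem_insert.1 hf with rfl | hf'
    · rcases Finset.mem_insert.1 hg with rfl | hg'
      · exact hee hfg
      · exact hne g (Finset.mem_of_mem_erase hg') (Finset.ne_of_mem_erase hg') hfg
    · rcases Finset.mem_insert.1 hg with rfl | hg'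
      · exact hne f (Finset.mem_of_mem_erase hf') (Finset.ne_of_mem_erase hf') hfg.symm
      · exact hT.2.1 f (Finset.mem_of_mem_erase hf') g (Finset.mem_of_mem_erase hg') hfg
  · rw [Finset.card_insert_of_notMem fun h => he (Finset.mem_of_mem_erase h),
      Finset.card_erase_of_mem hd, hT.2.2]
    have := Finset.card_pos.2 ⟨d, hd⟩
    rw [hT.2.2] at this
    omega

variable [NeZero n]

/-- The side from 0 to n-1 crosses nothing and is no diagonal, so adding it to `T` improves the
bound for chords by one. -/
theorem card_le_of_noncrossing_diagonals (hn : 3 ≤ n) {T : Finset (Sym2 (Fin n))}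
    (hT : ∀ d ∈ T, IsDiagonal n d) (hc : ∀ d ∈ T, ∀ e ∈ T, ¬ Crosses d e) : T.card ≤ n - 3 := by
  classical
  have hv0 : ((0 : Fin n) : ℕ) = 0 := Fin.val_zero n
  obtain ⟨l, hlv⟩ : ∃ l : Fin n, (l : ℕ) = n - 1 := ⟨⟨n - 1, by omega⟩, rfl⟩
  have hl : (0 : Fin n) < l := by rw [Fin.lt_def]; omega
  have hout : ∀ e, ¬ Crosses s(0, l) e := by
    rintro e ⟨a, b, c, x, h1, h2, h3, ⟨h4, h5⟩ | ⟨h4, h5⟩⟩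
    · obtain ⟨rfl, rfl⟩ := (Sym2.mk_eq_mk_iff_of_lt hl (h1.trans h2)).1 h4
      have := x.2
      rw [Fin.lt_def] at h3
      omega
    · obtain ⟨rfl, rfl⟩ := (Sym2.mk_eq_mk_iff_of_lt hl (h2.trans h3)).1 h4
      rw [Fin.lt_def] at h1
      omega
  have hnot : s(0, l) ∉ T := fun h => by
    have := (isDiagonal_mk_iff hl).1 (hT _ h)
    omega
  have := card_le_of_noncrossing_chords (T := insert s(0, l) T) ?_ ?_
  · rw [Finset.card_insert_of_notMem hnot] at this
    omega
  · intro d hd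
    rcases Finset.mem_insert.1 hd with rfl | hd
    · exact ⟨0, l, rfl, by omega⟩
    · obtain ⟨i, j, h, rfl⟩ := (hT d hd).exists_lt
      exact ⟨i, j, rfl, ((isDiagonal_mk_iff h).1 (hT _ hd)).1⟩
  · intro d hd e he hde
    rcases Finset.mem_insert.1 hd with rfl | hd
    · exact hout _ hde
    · rcases Finset.mem_insert.1 he with rfl | he
      · exact hout _ hde.symm
      · exact hc d hd e he hde

/-- The triangulation `T'` arises from `T` by flipping a diagonal `ab` to `vw`, where `vab` is one
of the triangles of `T`. -/
def IsFlip (T T' : Finset (Sym2 (Fin n))) (v w : Fin n) : Prop :=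
  ∃ a b : Fin n, s(a, b) ∈ T ∧ T' = insert s(v, w) (T.erase s(a, b)) ∧ Crosses s(a, b) s(v, w) ∧
    ∀ x, x = a ∨ x = b → s(v, x) ∈ T ∨ ¬ IsDiagonal n s(v, x)

/-- Let `a` and `b` be the neighbours of 0 in `T`, sides included, that are nearest to the missing
`w` on either side. Then `ab` crosses nothing in `T`, so it lies in `T` by maximality, and 0, `a`,
`b` span a triangle. Flipping `ab` joins 0 to the apex on the far side. -/
theorem exists_isFlip_zero (hn : 5 ≤ n) {T : Finset (Sym2 (Fin n))} (hT : T ∈ triangulations n)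
    {w : Fin n} (hw : IsDiagonal n s(0, w)) (hwT : s(0, w) ∉ T) :
    ∃ T' ∈ triangulations n, ∃ c, IsFlip T T' 0 c := by
  classical
  have hv0 : ((0 : Fin n) : ℕ) = 0 := Fin.val_zero n
  have h0w : (0 : Fin n) < w := by
    refine lt_of_le_of_ne (Fin.zero_le w) ?_
    rintro rfl
    exact not_isDiagonal_mk_self _ hw
  rw [isDiagonal_mk_iff h0w, hv0] at hw
  let A := Finset.univ.filter fun a : Fin n => 0 < a ∧ a < w ∧ ((a : ℕ) = 1 ∨ s(0, a) ∈ T)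
  let B := Finset.univ.filter fun b : Fin n => w < b ∧ ((b : ℕ) + 1 = n ∨ s(0, b) ∈ T)
  have hA : A.Nonempty := by
    refine ⟨⟨1, by omega⟩, ?_⟩
    simp only [A, Finset.mem_filter, Finset.mem_univ, true_and, Fin.lt_def, hv0]
    exact ⟨by omega, by omega, Or.inl trivial⟩
  have hB : B.Nonempty := by
    refine ⟨⟨n - 1, by omega⟩, ?_⟩
    simp only [B, Finset.mem_filter, Finset.mem_univ, true_and, Fin.lt_def]
    exact ⟨by omega, Or.inl (by omega)⟩
  obtain ⟨a, ha, hamax⟩ : ∃ a ∈ A, ∀ a' ∈ A, a' ≤ a := ⟨_, A.max'_mem hA, fun a h => A.le_max' a h⟩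
  obtain ⟨b, hb, hbmin⟩ : ∃ b ∈ B, ∀ b' ∈ B, b ≤ b' := ⟨_, B.min'_mem hB, fun a h => B.min'_le a h⟩
  simp only [A, B, Finset.mem_filter, Finset.mem_univ, true_and, and_imp] at ha hb hamax hbmin
  obtain ⟨ha0, haw, haT⟩ := ha
  obtain ⟨hwb, hbT⟩ := hb
  have hab : a < b := haw.trans hwb
  have hdiag : IsDiagonal n s(a, b) := by
    rw [isDiagonal_mk_iff hab]
    rw [Fin.lt_def] at ha0 haw hwb
    omega
  have hncr : ∀ x y, x < y → s(x, y) ∈ T → ¬ Crosses s(a, b) s(x, y) := by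
    intro x y hxy hT' hcr
    rw [crosses_mk_iff hab hxy] at hcr
    rcases hcr with ⟨h1, h2, h3⟩ | ⟨h1, h2, h3⟩
    · rcases hbT with h | h
      · have := y.2
        rw [Fin.lt_def] at h3
        omega
      · exact hT.2.1 _ h _ hT' (Crosses.of_cyclic (ha0.trans h1) h2 h3)
    · rcases (Fin.zero_le x).eq_or_lt with rfl | hx
      · rcases lt_trichotomy y w with h | rfl | h
        · exact absurd (hamax y hxy h (Or.inr hT')) (not_le.2 h2)
        · exact hwT hT'
        · exact absurd (hbmin y h (Or.inr hT')) (not_le.2 h3)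
      · rcases haT with h | h
        · rw [Fin.lt_def] at hx h1
          omega
        · exact hT.2.1 _ h _ hT' (Crosses.of_cyclic hx h1 h2)
  have habT : s(a, b) ∈ T := by
    by_contra hno
    have := card_le_of_noncrossing_diagonals (T := insert s(a, b) T) (by omega) ?_ ?_
    · rw [Finset.card_insert_of_notMem hno, hT.2.2] at this
      omega
    · intro d hd
      rcases Finset.mem_insert.1 hd with rfl | hd
      · exact hdiag
      · exact hT.1 d hd
    · have hd : ∀ d ∈ T, ¬ Crosses s(a, b) d := by
        intro d hd
        obtain ⟨x, y, hxy, rfl⟩ := (hT.1 d hd).exists_lt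
        exact hncr x y hxy hd
      intro d hd' e he hde
      rcases Finset.mem_insert.1 hd' with rfl | hd'
      · rcases Finset.mem_insert.1 he with rfl | he
        · rw [crosses_mk_iff hab hab] at hde
          simp at hde
        · exact hd e he hde
      · rcases Finset.mem_insert.1 he with rfl | he
        · exact hd d hd' hde.symm
        · exact hT.2.1 d hd' e he hde
  obtain ⟨c, hac, hcb, hcT, hcmax⟩ := exists_apex T (i := a) (j := b)
    ((isDiagonal_mk_iff hab).1 hdiag).1
  have h0c : (0 : Fin n) < c := ha0.trans hac
  have hcr : Crosses s(a, b) s(0, c) := (Crosses.of_cyclic ha0 hac hcb).symm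
  have hcnT : s(0, c) ∉ T := fun h => hT.2.1 _ habT _ h hcr
  refine ⟨insert s(0, c) (T.erase s(a, b)), ?_, c, a, b, habT, rfl, hcr, ?_⟩
  · refine mem_triangulations_of_flip (by omega) hT habT hcnT ?_ ?_
    · rw [isDiagonal_mk_iff h0c]
      have := b.2
      rw [Fin.lt_def] at ha0 hac hcb
      omega
    · intro f hf hne hcross
      obtain ⟨x, y, hxy, rfl⟩ := (hT.1 f hf).exists_lt
      rw [crosses_mk_iff h0c hxy] at hcross
      rcases hcross with ⟨h1, h2, h3⟩ | ⟨h1, -, -⟩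
      · have hxa : a ≤ x := by
          by_contra hlt
          rw [not_le] at hlt
          rcases haT with h | h
          · rw [Fin.lt_def] at h1 hlt
            omega
          · exact hT.2.1 _ h _ hf (Crosses.of_cyclic h1 hlt (hac.trans h3))
        have hyb : y ≤ b := by
          by_contra hlt
          rw [not_le] at hlt
          rcases hbT with h | h
          · have := y.2
            rw [Fin.lt_def] at hlt
            omega
          · exact hT.2.1 _ h _ hf (Crosses.of_cyclic h1 (h2.trans hcb) hlt)
        rcases hxa.eq_or_lt with rfl | hxa
        · rcases hyb.eq_or_lt with rfl | hyb
          · exact hne rfl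
          · exact hcmax y h3 hyb hf
        · rcases hcT with h | h
          · rw [Fin.lt_def] at hxa h2
            omega
          · exact hT.2.1 _ h _ hf (Crosses.of_cyclic hxa h2 h3)
      · exact absurd h1 (not_lt.2 (Fin.zero_le x))
  · rintro x (rfl | rfl)
    · rcases haT with h | h
      · right
        rw [isDiagonal_mk_iff ha0]
        omega
      · exact Or.inl h
    · rcases hbT with h | h
      · right
        rw [isDiagonal_mk_iff (ha0.trans hab)]
        omega
      · exact Or.inl h

theorem IsFlip.exists_zero_lt {T T' : Finset (Sym2 (Fin n))} {w : Fin n} (h : IsFlip T T' 0 w)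
    (hT : T ∈ triangulations n) :
    ∃ a b : Fin n, 0 < a ∧ a < w ∧ w < b ∧ s(a, b) ∈ T ∧ T' = insert s(0, w) (T.erase s(a, b)) ∧
      T = insert s(a, b) (T'.erase s(0, w)) ∧
      ((a : ℕ) = 1 ∨ s(0, a) ∈ T) ∧ ((b : ℕ) + 1 = n ∨ s(0, b) ∈ T) := by
  have hv0 : ((0 : Fin n) : ℕ) = 0 := Fin.val_zero n
  have key : ∀ a b : Fin n, a < b → s(a, b) ∈ T → T' = insert s(0, w) (T.erase s(a, b)) →
      Crosses s(a, b) s(0, w) → (s(0, a) ∈ T ∨ ¬ IsDiagonal n s(0, a)) →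
      (s(0, b) ∈ T ∨ ¬ IsDiagonal n s(0, b)) →
      ∃ a b : Fin n, 0 < a ∧ a < w ∧ w < b ∧ s(a, b) ∈ T ∧ T' = insert s(0, w) (T.erase s(a, b)) ∧
      T = insert s(a, b) (T'.erase s(0, w)) ∧
      ((a : ℕ) = 1 ∨ s(0, a) ∈ T) ∧ ((b : ℕ) + 1 = n ∨ s(0, b) ∈ T) := by
    intro a b hab habT hT' hcr ha hb
    have h0w : (0 : Fin n) < w := by
      refine lt_of_le_of_ne (Fin.zero_le w) ?_
      rintro rfl
      obtain ⟨p, q, r, s, h1, h2, h3, ⟨-, h4⟩ | ⟨-, h4⟩⟩ := hcr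
      · rcases Sym2.eq_iff.1 h4 with ⟨rfl, rfl⟩ | ⟨rfl, rfl⟩ <;> exact lt_irrefl _ (h2.trans h3)
      · rcases Sym2.eq_iff.1 h4 with ⟨rfl, rfl⟩ | ⟨rfl, rfl⟩ <;> exact lt_irrefl _ (h1.trans h2)
    have hnT : s(0, w) ∉ T := fun h => hT.2.1 _ habT _ h hcr
    rw [crosses_mk_iff hab h0w] at hcr
    rcases hcr with ⟨h1, -, -⟩ | ⟨h1, h2, h3⟩
    · exact absurd h1 (not_lt.2 (Fin.zero_le a))
    · refine ⟨a, b, h1, h2, h3, habT, hT', ?_, ?_, ?_⟩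
      · rw [hT', Finset.erase_insert fun h => hnT (Finset.mem_of_mem_erase h),
          Finset.insert_erase habT]
      · rcases ha with h | h
        · exact Or.inr h
        · left
          rw [isDiagonal_mk_iff h1] at h
          have := b.2
          rw [Fin.lt_def] at h1 hab
          omega
      · rcases hb with h | h
        · exact Or.inr h
        · left
          rw [isDiagonal_mk_iff (h1.trans hab)] at h
          rw [Fin.lt_def] at h1 hab
          omega
  obtain ⟨a, b, habT, hT', hcr, hx⟩ := h
  rcases lt_trichotomy a b with h | rfl | h
  · exact key a b h habT hT' hcr (hx a (Or.inl rfl)) (hx b (Or.inr rfl))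
  · exact absurd (hT.1 _ habT) (not_isDiagonal_mk_self a)
  · rw [Sym2.eq_swap (a := a)] at habT hT' hcr
    exact key b a h habT hT' hcr (hx b (Or.inr rfl)) (hx a (Or.inl rfl))

/-- The removed chord joins the neighbours of 0 next to `w` on either side, and these can be read
off from `T'`. The proof compares two candidates: the chords at 0 other than `0w` are common to both
triangulations and confine `a₁b₁` and `a₂b₂` to each other. -/
theorem IsFlip.unique_zero {T₁ T₂ T' : Finset (Sym2 (Fin n))} {w : Fin n}
    (h₁ : IsFlip T₁ T' 0 w) (h₂ : IsFlip T₂ T' 0 w) (hT₁ : T₁ ∈ triangulations n)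
    (hT₂ : T₂ ∈ triangulations n) : T₁ = T₂ := by
  have key : ∀ (T₁ T₂ : Finset (Sym2 (Fin n))) (a₁ b₁ a₂ b₂ : Fin n), T₁ ∈ triangulations n →
      0 < a₁ → a₁ < w → w < b₁ → s(a₁, b₁) ∈ T₁ → T₁ = insert s(a₁, b₁) (T'.erase s(0, w)) →
      0 < a₂ → a₂ < w → w < b₂ → T' = insert s(0, w) (T₂.erase s(a₂, b₂)) →
      ((a₂ : ℕ) = 1 ∨ s(0, a₂) ∈ T₂) → ((b₂ : ℕ) + 1 = n ∨ s(0, b₂) ∈ T₂) →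
      a₂ ≤ a₁ ∧ b₁ ≤ b₂ := by
    intro T₁ T₂ a₁ b₁ a₂ b₂ hT₁ h0a haw hwb hm₁ he₁ h0a₂ haw₂ hwb₂ he₂ ha₂ hb₂
    have hmem : ∀ x : Fin n, 0 < x → x ≠ w → s(0, x) ∈ T₂ → s(0, x) ∈ T₁ := by
      intro x h0x hxw hx
      rw [he₁]
      refine Finset.mem_insert_of_mem (Finset.mem_erase.2 ⟨?_, ?_⟩)
      · intro h
        exact hxw ((Sym2.mk_eq_mk_iff_of_lt h0x (h0a.trans haw)).1 h).2
      · rw [he₂]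
        refine Finset.mem_insert_of_mem (Finset.mem_erase.2 ⟨?_, hx⟩)
        intro h
        exact h0a₂.ne ((Sym2.mk_eq_mk_iff_of_lt h0x (haw₂.trans hwb₂)).1 h).1
    constructor
    · by_contra hlt
      rw [not_le] at hlt
      rcases ha₂ with h | h
      · rw [Fin.lt_def] at hlt h0a
        omega
      · exact hT₁.2.1 _ (hmem a₂ (h0a.trans hlt) haw₂.ne h) _ hm₁
          (Crosses.of_cyclic h0a hlt (haw₂.trans hwb))
    · by_contra hlt
      rw [not_le] at hlt
      rcases hb₂ with h | h
      · have := b₁.2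
        rw [Fin.lt_def] at hlt
        omega
      · exact hT₁.2.1 _ (hmem b₂ ((h0a.trans haw).trans hwb₂) hwb₂.ne' h) _ hm₁
          (Crosses.of_cyclic h0a (haw.trans hwb₂) hlt)
  obtain ⟨a₁, b₁, h1, h2, h3, h4, h5, h6, h7, h8⟩ := h₁.exists_zero_lt hT₁
  obtain ⟨a₂, b₂, k1, k2, k3, k4, k5, k6, k7, k8⟩ := h₂.exists_zero_lt hT₂
  have e1 := key T₁ T₂ a₁ b₁ a₂ b₂ hT₁ h1 h2 h3 h4 h6 k1 k2 k3 k5 k7 k8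
  have e2 := key T₂ T₁ a₂ b₂ a₁ b₁ hT₂ k1 k2 k3 k4 k6 h1 h2 h3 h5 h7 h8
  rw [h6, k6, le_antisymm e2.1 e1.1, le_antisymm e1.2 e2.2]

end Noncrossing

/-! ### Vertex degrees, maximal flips and the rotation of triangulations -/

section RotateTriangulation

variable {n : ℕ}

/-- The number of chords of `T` at the vertex `v`. -/
def chordDegree (T : Finset (Sym2 (Fin n))) (v : Fin n) : ℕ := (T.filter (v ∈ ·)).card

/-- The largest number of chords of `T` at a vertex. -/
def maxChordDegree (T : Finset (Sym2 (Fin n))) : ℕ := Finset.univ.sup (chordDegree T)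

theorem chordDegree_le_maxChordDegree (T : Finset (Sym2 (Fin n))) (v : Fin n) :
    chordDegree T v ≤ maxChordDegree T := Finset.le_sup (Finset.mem_univ v)

theorem chordDegree_insert_erase_le (T : Finset (Sym2 (Fin n))) (d e : Sym2 (Fin n)) (u : Fin n) :
    chordDegree (insert e (T.erase d)) u ≤ chordDegree T u + 1 := by
  rw [chordDegree, chordDegree, Finset.filter_insert]
  have h : ((T.erase d).filter (u ∈ ·)).card ≤ (T.filter (u ∈ ·)).card :=
    Finset.card_le_card (Finset.filter_subset_filter _ (Finset.erase_subset _ _))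
  split_ifs
  · exact (Finset.card_insert_le _ _).trans (by omega)
  · omega

theorem chordDegree_insert_erase_le_of_notMem (T : Finset (Sym2 (Fin n))) (d : Sym2 (Fin n))
    {e : Sym2 (Fin n)} {u : Fin n} (hu : u ∉ e) :
    chordDegree (insert e (T.erase d)) u ≤ chordDegree T u := by
  rw [chordDegree, chordDegree, Finset.filter_insert, if_neg hu]
  exact Finset.card_le_card (Finset.filter_subset_filter _ (Finset.erase_subset _ _))

theorem Crosses.notMem {d e : Sym2 (Fin n)} (h : Crosses d e) {v : Fin n} (hv : v ∈ e) :
    v ∉ d := by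
  obtain ⟨a, b, c, x, h1, h2, h3, ⟨rfl, rfl⟩ | ⟨rfl, rfl⟩⟩ := h <;>
  · rw [Sym2.mem_iff] at hv ⊢
    rcases hv with rfl | rfl <;> rintro (rfl | rfl) <;>
      simp only [Fin.lt_def] at h1 h2 h3 <;> omega

/-- `T'` is obtained from `T` by a flip which creates a diagonal at a vertex of maximal degree. -/
def IsMaxFlip (T T' : Finset (Sym2 (Fin n))) (v w : Fin n) : Prop :=
  IsFlip T T' v w ∧ chordDegree T v = maxChordDegree T

theorem IsMaxFlip.ne {T T' : triangulations n} {v w : Fin n} (h : IsMaxFlip T.1 T'.1 v w) :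
    v ≠ w := by
  obtain ⟨a, b, -, h2, -⟩ := h.1
  rintro rfl
  exact not_isDiagonal_mk_self v (T'.2.1 _ (h2 ▸ Finset.mem_insert_self _ _))

theorem kneserGraph_adj_of_disjoint (hn : 5 ≤ n) {S T : triangulations n}
    (h : Disjoint S.1 T.1) : (kneserGraph (triangulations n)).Adj S T := by
  refine ⟨?_, h⟩
  rintro rfl
  have h1 := S.2.2.2
  rw [disjoint_self.1 h, Finset.bot_eq_empty, Finset.card_empty] at h1
  omega

/-- The removed chord crosses `vw`, so it does not end at `v`. -/
theorem IsFlip.chordDegree_eq {T T' : Finset (Sym2 (Fin n))} {v w : Fin n} (h : IsFlip T T' v w)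
    (hT : T ∈ triangulations n) : chordDegree T' v = chordDegree T v + 1 := by
  obtain ⟨a, b, h1, rfl, h3, -⟩ := h
  have hvw : v ∈ s(v, w) := Sym2.mem_mk_left v w
  rw [chordDegree, chordDegree, Finset.filter_insert, if_pos hvw, Finset.card_insert_of_notMem,
    Finset.filter_erase, Finset.erase_eq_of_notMem]
  · exact fun h => h3.notMem hvw (Finset.mem_filter.1 h).2
  · intro h
    exact hT.2.1 _ h1 _ (Finset.mem_of_mem_erase (Finset.mem_filter.1 h).1) h3

theorem IsMaxFlip.maxChordDegree_lt {T T' : Finset (Sym2 (Fin n))} {v w : Fin n}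
    (h : IsMaxFlip T T' v w) (hT : T ∈ triangulations n) :
    maxChordDegree T < maxChordDegree T' := by
  have := chordDegree_le_maxChordDegree T' v
  rw [h.1.chordDegree_eq hT, h.2] at this
  omega

theorem IsMaxFlip.chordDegree_eq_maxChordDegree {T T' : Finset (Sym2 (Fin n))} {v w : Fin n}
    (h : IsMaxFlip T T' v w) (hT : T ∈ triangulations n) :
    chordDegree T' v = maxChordDegree T' := by
  apply le_antisymm (chordDegree_le_maxChordDegree _ _)
  refine Finset.sup_le fun u _ => ?_
  rw [h.1.chordDegree_eq hT, h.2]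
  obtain ⟨a, b, -, rfl, -⟩ := h.1
  exact (chordDegree_insert_erase_le _ _ _ _).trans
    (Nat.add_le_add_right (chordDegree_le_maxChordDegree T u) 1)

/-- A vertex off `vw` gains no chord, while the maximum has grown. -/
theorem IsMaxFlip.eq_or_eq {T T' : Finset (Sym2 (Fin n))} {v w : Fin n}
    (h : IsMaxFlip T T' v w) (hT : T ∈ triangulations n) {u : Fin n}
    (hu : chordDegree T' u = maxChordDegree T') : u = v ∨ u = w := by
  have h1 := h.maxChordDegree_lt hT
  obtain ⟨a, b, -, rfl, -⟩ := h.1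
  by_contra hne
  have h2 := chordDegree_insert_erase_le_of_notMem T s(a, b) (mt Sym2.mem_iff.1 hne)
  have h3 := chordDegree_le_maxChordDegree T u
  omega

variable [NeZero n]

theorem mem_image_rotateChord {T : Finset (Sym2 (Fin n))} {d : Sym2 (Fin n)} :
    rotateChord d ∈ T.image rotateChord ↔ d ∈ T :=
  rotateChord_injective.mem_finset_image

theorem image_rotateChord_mem_triangulations (hn : 2 ≤ n) {T : Finset (Sym2 (Fin n))}
    (hT : T ∈ triangulations n) : T.image rotateChord ∈ triangulations n := by
  refine ⟨?_, ?_, ?_⟩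
  · intro d hd
    obtain ⟨d, hd', rfl⟩ := Finset.mem_image.1 hd
    exact (isDiagonal_rotateChord hn).2 (hT.1 d hd')
  · intro d hd e he
    obtain ⟨d, hd', rfl⟩ := Finset.mem_image.1 hd
    obtain ⟨e, he', rfl⟩ := Finset.mem_image.1 he
    rw [crosses_rotateChord hn]
    exact hT.2.1 d hd' e he'
  · rw [Finset.card_image_of_injective _ rotateChord_injective, hT.2.2]

theorem isFlip_image_rotateChord (hn : 2 ≤ n) {T T' : Finset (Sym2 (Fin n))} {v w : Fin n} :
    IsFlip (T.image rotateChord) (T'.image rotateChord) (v + 1) (w + 1) ↔ IsFlip T T' v w := by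
  have himage : ∀ a b : Fin n, T'.image rotateChord =
      insert s(v + 1, w + 1) ((T.image rotateChord).erase s(a + 1, b + 1)) ↔
        T' = insert s(v, w) (T.erase s(a, b)) := by
    intro a b
    rw [← rotateChord_mk, ← rotateChord_mk, ← Finset.image_erase rotateChord_injective,
      ← Finset.image_insert, (Finset.image_injective rotateChord_injective).eq_iff]
  constructor
  · rintro ⟨a, b, h1, h2, h3, h4⟩
    obtain ⟨a, rfl⟩ := (Equiv.addRight (1 : Fin n)).surjective a
    obtain ⟨b, rfl⟩ := (Equiv.addRight (1 : Fin n)).surjective b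
    simp only [Equiv.coe_addRight] at h1 h2 h3 h4
    rw [← rotateChord_mk, mem_image_rotateChord] at h1
    rw [himage] at h2
    rw [← rotateChord_mk, ← rotateChord_mk, crosses_rotateChord hn] at h3
    refine ⟨a, b, h1, h2, h3, fun x hx => ?_⟩
    have := h4 (x + 1) (by rcases hx with rfl | rfl <;> simp)
    rwa [← rotateChord_mk, mem_image_rotateChord, isDiagonal_rotateChord hn] at this
  · rintro ⟨a, b, h1, h2, h3, h4⟩
    refine ⟨a + 1, b + 1, ?_, ?_, ?_, ?_⟩
    · rwa [← rotateChord_mk, mem_image_rotateChord]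
    · rwa [himage]
    · rwa [← rotateChord_mk, ← rotateChord_mk, crosses_rotateChord hn]
    · intro x hx
      obtain ⟨x, rfl⟩ := (Equiv.addRight (1 : Fin n)).surjective x
      simp only [Equiv.coe_addRight, add_left_inj] at hx ⊢
      rw [← rotateChord_mk, mem_image_rotateChord, isDiagonal_rotateChord hn]
      exact h4 x hx

/-- The rotation of the `n`-gon by one step, acting on triangulations. -/
noncomputable def rotateTriangulation (hn : 2 ≤ n) : Equiv.Perm (triangulations n) :=
  Equiv.ofBijective
    (fun T => ⟨T.1.image rotateChord, image_rotateChord_mem_triangulations hn T.2⟩)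
    (Finite.injective_iff_bijective.1 fun _ _ h =>
      Subtype.ext (Finset.image_injective rotateChord_injective (congrArg Subtype.val h)))

theorem coe_rotateTriangulation (hn : 2 ≤ n) (T : triangulations n) :
    (rotateTriangulation hn T : Finset (Sym2 (Fin n))) = T.1.image rotateChord := rfl

theorem isFlip_rotateTriangulation (hn : 2 ≤ n) {T T' : triangulations n} {v w : Fin n} :
    IsFlip (rotateTriangulation hn T).1 (rotateTriangulation hn T').1 (v + 1) (w + 1) ↔
      IsFlip T.1 T'.1 v w :=
  isFlip_image_rotateChord hn

theorem exists_isFlip (hn : 5 ≤ n) (v : Fin n) (T : triangulations n)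
    (h : ∃ w, IsDiagonal n s(v, w) ∧ s(v, w) ∉ T.1) :
    ∃ (T' : triangulations n) (w : Fin n), IsFlip T.1 T'.1 v w := by
  have h2 : 2 ≤ n := by omega
  revert T h
  induction v using Fin.cyclic_induction h2 with
  | h0 =>
    rintro T ⟨w, hw, hwT⟩
    obtain ⟨T', hT', c, hc⟩ := exists_isFlip_zero hn T.2 hw hwT
    exact ⟨⟨T', hT'⟩, c, hc⟩
  | hs v ih =>
    rintro T ⟨w, hw, hwT⟩
    obtain ⟨T', c, hc⟩ := ih (rotateTriangulation h2 T) ⟨w + 1, by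
      rw [← rotateChord_mk]
      exact ⟨(isDiagonal_rotateChord h2).2 hw, fun h => hwT (mem_image_rotateChord.1 h)⟩⟩
    obtain ⟨T', rfl⟩ := (rotateTriangulation h2).surjective T'
    obtain ⟨c, rfl⟩ := (Equiv.addRight (1 : Fin n)).surjective c
    exact ⟨T', c, (isFlip_rotateTriangulation h2).1 hc⟩

theorem IsFlip.unique (hn : 2 ≤ n) {v w : Fin n} {T₁ T₂ T' : triangulations n}
    (h₁ : IsFlip T₁.1 T'.1 v w) (h₂ : IsFlip T₂.1 T'.1 v w) : T₁ = T₂ := by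
  revert w T₁ T₂ T'
  induction v using Fin.cyclic_induction hn with
  | h0 =>
    intro w T₁ T₂ T' h₁ h₂
    exact Subtype.ext (h₁.unique_zero h₂ T₁.2 T₂.2)
  | hs v ih =>
    intro w T₁ T₂ T' h₁ h₂
    exact (rotateTriangulation hn).injective (ih ((isFlip_rotateTriangulation hn).2 h₁)
      ((isFlip_rotateTriangulation hn).2 h₂))

theorem exists_chordDegree_eq_maxChordDegree (T : Finset (Sym2 (Fin n))) :
    ∃ v, chordDegree T v = maxChordDegree T := by
  obtain ⟨v, -, hv⟩ := Finset.exists_mem_eq_sup Finset.univ Finset.univ_nonempty (chordDegree T)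
  exact ⟨v, hv.symm⟩

theorem mem_rotateChord {d : Sym2 (Fin n)} {v : Fin n} : v + 1 ∈ rotateChord d ↔ v ∈ d := by
  rw [rotateChord, Sym2.mem_map]
  simp

theorem chordDegree_image_rotateChord (T : Finset (Sym2 (Fin n))) (v : Fin n) :
    chordDegree (T.image rotateChord) (v + 1) = chordDegree T v := by
  rw [chordDegree, Finset.filter_image, Finset.card_image_of_injective _ rotateChord_injective,
    chordDegree]
  simp only [mem_rotateChord]

theorem maxChordDegree_image_rotateChord (T : Finset (Sym2 (Fin n))) :
    maxChordDegree (T.image rotateChord) = maxChordDegree T := by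
  apply le_antisymm
  · refine Finset.sup_le fun v _ => ?_
    obtain ⟨v, rfl⟩ := (Equiv.addRight (1 : Fin n)).surjective v
    rw [Equiv.coe_addRight, chordDegree_image_rotateChord]
    exact chordDegree_le_maxChordDegree T v
  · refine Finset.sup_le fun v _ => ?_
    rw [← chordDegree_image_rotateChord]
    exact chordDegree_le_maxChordDegree _ _

theorem chordDegree_pow_rotateTriangulation (hn : 2 ≤ n) (T : triangulations n) (v : Fin n)
    (k : ℕ) : chordDegree ((rotateTriangulation hn ^ k) T).1 ((· + 1)^[k] v) =
      chordDegree T.1 v := by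
  induction k with
  | zero => rfl
  | succ k ih =>
    rw [Function.iterate_succ_apply', pow_succ', Equiv.Perm.mul_apply, coe_rotateTriangulation,
      chordDegree_image_rotateChord, ih]

/-- Otherwise `v`, `v + 2`, `v + 4` would all have maximal degree. They are distinct for n ≥ 5, but
only `v` and `w` qualify. -/
theorem IsMaxFlip.rotate_rotate_ne (hn : 5 ≤ n) (h2 : 2 ≤ n) {T T' : triangulations n} {v w : Fin n}
    (h : IsMaxFlip T.1 T'.1 v w) :
    rotateTriangulation h2 (rotateTriangulation h2 T') ≠ T' := by
  intro he
  have hstep : ∀ u, chordDegree T'.1 u = maxChordDegree T'.1 →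
      chordDegree T'.1 (u + 1 + 1) = maxChordDegree T'.1 := by
    intro u hu
    conv_lhs => rw [← he]
    rw [coe_rotateTriangulation, coe_rotateTriangulation, chordDegree_image_rotateChord,
      chordDegree_image_rotateChord, hu]
  have hv := h.chordDegree_eq_maxChordDegree T.2
  have e1 := h.eq_or_eq T.2 (hstep _ hv)
  have e2 := h.eq_or_eq T.2 (hstep _ (hstep _ hv))
  have v1 := Fin.val_add_one_eq_ite h2 v
  have v2 := Fin.val_add_one_eq_ite h2 (v + 1)
  have v3 := Fin.val_add_one_eq_ite h2 (v + 1 + 1)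
  have v4 := Fin.val_add_one_eq_ite h2 (v + 1 + 1 + 1)
  rw [Fin.ext_iff, Fin.ext_iff] at e1 e2
  rw [v1] at v2
  rw [v2] at v3
  rw [v3] at v4
  have := v.2
  split_ifs at v2 v3 v4 <;> omega

theorem IsMaxFlip.ncard_add_one_le (hn : 5 ≤ n) (h2 : 2 ≤ n) {T T' : triangulations n} {v w : Fin n}
    (h : IsMaxFlip T.1 T'.1 v w) :
    {S : triangulations n | ∃ v w, IsMaxFlip S.1 T'.1 v w}.ncard + 1 ≤
      {S | (rotateTriangulation h2).SameCycle T' S}.ncard := by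
  classical
  -- A predecessor is determined by its pair `(v, w)`, so counting pairs suffices.
  have hinj : ∀ B : Set (Fin n × Fin n),
      (∀ S : triangulations n, ∀ v w, IsMaxFlip S.1 T'.1 v w → (v, w) ∈ B) →
      {S : triangulations n | ∃ v w, IsMaxFlip S.1 T'.1 v w}.ncard ≤ B.ncard := by
    intro B hB
    have hch : ∀ S : triangulations n, ∃ p : Fin n × Fin n,
        (∃ v w, IsMaxFlip S.1 T'.1 v w) → IsMaxFlip S.1 T'.1 p.1 p.2 := by
      intro S
      by_cases hS : ∃ v w, IsMaxFlip S.1 T'.1 v w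
      · obtain ⟨v, w, hS⟩ := hS
        exact ⟨(v, w), fun _ => hS⟩
      · exact ⟨(v, w), fun h => absurd h hS⟩
    choose f hf using hch
    refine Set.ncard_le_ncard_of_injOn f (fun S hS => hB S _ _ (hf S hS)) ?_
    intro S hS S' hS' he
    have k1 := (hf S hS).1
    have k2 := (hf S' hS').1
    rw [he] at k1
    exact k1.unique h2 k2
  have hv := h.chordDegree_eq_maxChordDegree T.2
  -- With two vertices of maximal degree, every flip into `T'` creates the chord between them.
  by_cases hM : ∃ u, u ≠ v ∧ chordDegree T'.1 u = maxChordDegree T'.1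
  · obtain ⟨u, huv, hu⟩ := hM
    have hle : {S : triangulations n | ∃ v w, IsMaxFlip S.1 T'.1 v w}.ncard ≤ 2 := by
      refine (hinj {(v, u), (u, v)} ?_).trans ((Set.ncard_insert_le _ _).trans (by simp))
      intro S v' w' hS
      rcases hS.eq_or_eq S.2 hv with rfl | rfl
      · rcases hS.eq_or_eq S.2 hu with rfl | rfl
        · exact absurd rfl huv
        · simp
      · rcases hS.eq_or_eq S.2 hu with rfl | rfl
        · simp
        · exact absurd rfl huv
    have hsub : ({T', rotateTriangulation h2 T',
        rotateTriangulation h2 (rotateTriangulation h2 T')} : Set (triangulations n)) ⊆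
          {S | (rotateTriangulation h2).SameCycle T' S} := by
      rintro S (rfl | rfl | rfl)
      · exact Equiv.Perm.SameCycle.refl _ _
      · exact Equiv.Perm.sameCycle_apply_right.2 (Equiv.Perm.SameCycle.refl _ _)
      · exact Equiv.Perm.sameCycle_apply_right.2
          (Equiv.Perm.sameCycle_apply_right.2 (Equiv.Perm.SameCycle.refl _ _))
    have hne := h.rotate_rotate_ne hn h2
    have hne1 : rotateTriangulation h2 T' ≠ T' := fun he => hne (by rw [he, he])
    have h3 := Set.ncard_le_ncard hsub
    rw [Set.ncard_insert_of_notMem, Set.ncard_pair] at h3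
    · omega
    · exact fun he => hne1 ((rotateTriangulation h2).injective he).symm
    · rintro (he | he)
      · exact hne1 he.symm
      · exact hne he.symm
  · push Not at hM
    have hle : {S : triangulations n | ∃ v w, IsMaxFlip S.1 T'.1 v w}.ncard ≤ n - 1 := by
      refine (hinj (({v}ᶜ : Set (Fin n)).image (Prod.mk v)) ?_).trans ?_
      · intro S v' w' hS
        have : v' = v := by
          by_contra hne
          exact hM v' hne (hS.chordDegree_eq_maxChordDegree S.2)
        subst this
        exact ⟨w', hS.ne.symm, rfl⟩
      · rw [Set.ncard_image_of_injective _ (Prod.mk_right_injective v), Set.ncard_compl,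
          Nat.card_eq_fintype_card, Fintype.card_fin, Set.ncard_singleton]
    have hge : (Set.univ : Set (Fin n)).ncard ≤
        {S | (rotateTriangulation h2).SameCycle T' S}.ncard := by
      refine Set.ncard_le_ncard_of_injOn (fun i : Fin n => (rotateTriangulation h2 ^ (i : ℕ)) T')
        (fun i _ => Equiv.Perm.sameCycle_pow_right.2 (Equiv.Perm.SameCycle.refl _ _)) ?_
      intro i _ j _ hij
      have huniq : ∀ u, chordDegree T'.1 u = maxChordDegree T'.1 → u = v := by
        intro u hu
        by_contra hne
        exact hM u hne hu
      -- Equal rotates of `T'` have the same unique vertex of maximal degree.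
      have hit : (· + 1)^[(i : ℕ)] v = (· + 1)^[(j : ℕ)] v := by
        have hsurj : Function.Surjective ((· + 1)^[(j : ℕ)] : Fin n → Fin n) :=
          ((Equiv.addRight (1 : Fin n)).surjective).iterate _
        obtain ⟨u, hu⟩ := hsurj ((· + 1)^[(i : ℕ)] v)
        have k1 := chordDegree_pow_rotateTriangulation h2 T' v i
        have k2 := chordDegree_pow_rotateTriangulation h2 T' u j
        simp only at hij
        rw [hij, ← hu, k2, hv] at k1
        rw [← hu, huniq u k1]
      have hval := congrArg Fin.val hit
      rw [Fin.val_iterate_add_one, Fin.val_iterate_add_one] at hval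
      have := Nat.ModEq.add_left_cancel' (v : ℕ) hval
      rw [Nat.ModEq, Nat.mod_eq_of_lt i.2, Nat.mod_eq_of_lt j.2] at this
      exact Fin.ext this
    rw [Set.ncard_univ, Nat.card_eq_fintype_card, Fintype.card_fin] at hge
    omega

/-! ### The root orbit: fans -/

/-- The diagonals at the vertex `0`. -/
def fanZero (hn : 5 ≤ n) : Finset (Sym2 (Fin n)) :=
  Finset.univ.image fun k : Fin (n - 3) => s(0, ⟨(k : ℕ) + 2, by omega⟩)

theorem mem_fanZero_iff (hn : 5 ≤ n) {d : Sym2 (Fin n)} :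
    d ∈ fanZero hn ↔ IsDiagonal n d ∧ 0 ∈ d := by
  have hv0 : ((0 : Fin n) : ℕ) = 0 := Fin.val_zero n
  simp only [fanZero, Finset.mem_image, Finset.mem_univ, true_and]
  constructor
  · rintro ⟨k, rfl⟩
    refine ⟨?_, Sym2.mem_mk_left _ _⟩
    rw [isDiagonal_mk_iff (by rw [Fin.lt_def, hv0]; simp)]
    simp only [hv0]
    omega
  · rintro ⟨hd, hmem⟩
    obtain ⟨w, rfl⟩ := hmem
    have h0w : (0 : Fin n) < w := by
      refine lt_of_le_of_ne (Fin.zero_le w) ?_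
      rintro rfl
      exact not_isDiagonal_mk_self _ hd
    rw [isDiagonal_mk_iff h0w, hv0] at hd
    refine ⟨⟨(w : ℕ) - 2, by omega⟩, ?_⟩
    refine Sym2.congr_right.2 (Fin.ext ?_)
    simp only
    omega

theorem fanZero_mem_triangulations (hn : 5 ≤ n) : fanZero hn ∈ triangulations n := by
  refine ⟨fun d hd => ((mem_fanZero_iff hn).1 hd).1, fun d hd e he hde => ?_, ?_⟩
  · exact hde.notMem ((mem_fanZero_iff hn).1 he).2 ((mem_fanZero_iff hn).1 hd).2
  · rw [fanZero, Finset.card_image_of_injective, Finset.card_univ, Fintype.card_fin]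
    intro k l h
    have h' := Sym2.congr_right.1 h
    rw [Fin.ext_iff] at h' ⊢
    simpa using h'

theorem sameCycle_fanZero (hn : 5 ≤ n) (h2 : 2 ≤ n) (v : Fin n) (T : triangulations n)
    (hT : ∀ w, IsDiagonal n s(v, w) → s(v, w) ∈ T.1) :
    (rotateTriangulation h2).SameCycle ⟨fanZero hn, fanZero_mem_triangulations hn⟩ T := by
  revert T hT
  induction v using Fin.cyclic_induction h2 with
  | h0 =>
    intro T hT
    have : fanZero hn = T.1 := by
      apply Finset.Subset.antisymm
      · intro d hd
        obtain ⟨hd, w, rfl⟩ := (mem_fanZero_iff hn).1 hd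
        exact hT w hd
      · intro d hd
        refine (mem_fanZero_iff hn).2 ⟨T.2.1 d hd, ?_⟩
        by_contra h0
        have hdd := T.2.1 d hd
        obtain ⟨i, j, h, rfl⟩ := hdd.exists_lt
        rw [isDiagonal_mk_iff h] at hdd
        have hi : (0 : Fin n) < i := by
          refine lt_of_le_of_ne (Fin.zero_le i) ?_
          rintro rfl
          exact h0 (Sym2.mem_mk_left _ _)
        have hj := j.2
        have hv0 : ((0 : Fin n) : ℕ) = 0 := Fin.val_zero n
        have hi1 := Fin.val_add_one_eq_ite h2 i
        rw [if_neg (by omega)] at hi1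
        have hlt : i < i + 1 := by rw [Fin.lt_def]; omega
        -- A diagonal `ij` avoiding 0 is crossed by the diagonal from 0 to `i + 1`.
        refine T.2.2.1 _ (hT (i + 1) ?_) _ hd
          (Crosses.of_cyclic hi hlt (by rw [Fin.lt_def]; omega))
        rw [isDiagonal_mk_iff (hi.trans hlt)]
        rw [Fin.lt_def] at hi
        omega
    rw [show (⟨fanZero hn, fanZero_mem_triangulations hn⟩ : triangulations n) = T from
      Subtype.ext this]
  | hs v ih =>
    intro T hT
    refine Equiv.Perm.sameCycle_apply_right.1 (ih (rotateTriangulation h2 T) ?_)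
    intro w hw
    obtain ⟨w, rfl⟩ := (Equiv.addRight (1 : Fin n)).surjective w
    rw [Equiv.coe_addRight, ← rotateChord_mk] at hw ⊢
    exact mem_image_rotateChord.2 (hT w ((isDiagonal_rotateChord h2).1 hw))

/-- Two rotations take the diagonal from 0 to 2 to the one from 2 to 4, which misses 0 as n ≥ 5. -/
theorem rotate_rotate_fanZero_ne (hn : 5 ≤ n) (h2 : 2 ≤ n) :
    rotateTriangulation h2 (rotateTriangulation h2
      ⟨fanZero hn, fanZero_mem_triangulations hn⟩) ≠
        ⟨fanZero hn, fanZero_mem_triangulations hn⟩ := by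
  intro he
  have hv0 : ((0 : Fin n) : ℕ) = 0 := Fin.val_zero n
  have hmem : s(0, (⟨2, by omega⟩ : Fin n)) ∈ fanZero hn := by
    refine (mem_fanZero_iff hn).2 ⟨?_, Sym2.mem_mk_left _ _⟩
    rw [isDiagonal_mk_iff (by rw [Fin.lt_def, hv0]; simp)]
    simp only [hv0]
    omega
  have hmem' : rotateChord (rotateChord s(0, (⟨2, by omega⟩ : Fin n))) ∈ fanZero hn := by
    have := mem_image_rotateChord.2 (mem_image_rotateChord.2 hmem)
    rwa [show ((fanZero hn).image rotateChord).image rotateChord = fanZero hn from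
      congrArg Subtype.val he] at this
  have h0 := ((mem_fanZero_iff hn).1 hmem').2
  have v1 := Fin.val_add_one_eq_ite h2 0
  have v2 := Fin.val_add_one_eq_ite h2 (0 + 1)
  have v3 := Fin.val_add_one_eq_ite h2 (⟨2, by omega⟩ : Fin n)
  have v4 := Fin.val_add_one_eq_ite h2 ((⟨2, by omega⟩ : Fin n) + 1)
  rw [if_neg (by omega)] at v1
  rw [if_neg (by omega)] at v2
  rw [if_neg (by simp only; omega)] at v3
  rw [if_neg (by rw [v3]; simp only; omega)] at v4
  simp only at v3
  rw [rotateChord_mk, rotateChord_mk, Sym2.mem_iff, Fin.ext_iff, Fin.ext_iff] at h0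
  omega

/-! ### Adjacency between orbits -/

theorem disjoint_rotateTriangulation (h2 : 2 ≤ n) (T : triangulations n) :
    Disjoint T.1 (rotateTriangulation h2 T).1 := by
  rw [Finset.disjoint_right]
  intro d hd hdT
  obtain ⟨d, hd', rfl⟩ := Finset.mem_image.1 hd
  exact T.2.2.1 _ hd' _ hdT ((T.2.1 d hd').crosses_rotateChord h2)

/-- `T` and `T'` differ only in `ab` and `vw`, and each is disjoint from its own rotation. Failure
of the first alternative forces `ab` to rotate to `vw`, failure of the second forces `vw` to rotate
to `ab`; together they contradict `rotateChord_rotateChord_ne`. -/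
theorem IsFlip.disjoint_or_disjoint (hn : 5 ≤ n) (h2 : 2 ≤ n) {T T' : triangulations n}
    {v w : Fin n} (h : IsFlip T.1 T'.1 v w) :
    Disjoint (rotateTriangulation h2 T).1 T'.1 ∨ Disjoint T.1 (rotateTriangulation h2 T').1 := by
  obtain ⟨a, b, h1, hT', -, -⟩ := h
  have hdis := Finset.disjoint_left.1 (disjoint_rotateTriangulation h2 T)
  have hvw : s(v, w) ∈ T'.1 := hT' ▸ Finset.mem_insert_self _ _
  have hkeep : ∀ e ∈ T.1, e ≠ s(a, b) → e ∈ T'.1 := fun e he hne =>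
    hT' ▸ Finset.mem_insert_of_mem (Finset.mem_erase.2 ⟨hne, he⟩)
  have hcases : ∀ e ∈ T'.1, e = s(v, w) ∨ e ∈ T.1 := by
    intro e he
    rw [hT'] at he
    exact (Finset.mem_insert.1 he).imp_right Finset.mem_of_mem_erase
  by_contra hno
  push Not at hno
  obtain ⟨hno1, hno2⟩ := hno
  obtain ⟨e, he1, he2⟩ := Finset.not_disjoint_iff.1 hno1
  obtain ⟨f, hf1, hf2⟩ := Finset.not_disjoint_iff.1 hno2
  have k1 : rotateChord s(a, b) = s(v, w) := by
    rcases hcases e he2 with rfl | he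
    · obtain ⟨e₀, he₀, he⟩ := Finset.mem_image.1 he1
      rw [← he]
      by_contra hne
      have hne' : e₀ ≠ s(a, b) := fun h => hne (by rw [h])
      refine T'.2.2.1 _ (hkeep e₀ he₀ hne') _ hvw ?_
      rw [← he]
      exact (T.2.1 _ he₀).crosses_rotateChord h2
    · exact absurd he1 (hdis he)
  have k2 : rotateChord s(v, w) = s(a, b) := by
    obtain ⟨f₀, hf₀, rfl⟩ := Finset.mem_image.1 hf2
    rcases hcases f₀ hf₀ with rfl | hf
    · by_contra hne
      exact T'.2.2.1 _ hvw _ (hkeep _ hf1 hne) ((T'.2.1 _ hvw).crosses_rotateChord h2)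
    · exact absurd (mem_image_rotateChord.2 hf) (hdis hf1)
  exact rotateChord_rotateChord_ne hn (T.2.1 _ h1) (by rw [k1, k2])

end RotateTriangulation

theorem theorem1 (n : ℕ) (hn : 5 ≤ n) :
    ∃ (T : triangulations n) (p : (kneserGraph (triangulations n)).Walk T T),
      p.IsHamiltonianCycle := by
  have : NeZero n := ⟨by omega⟩
  have h2 : 2 ≤ n := by omega
  have : Fintype (triangulations n) := Fintype.ofFinite _
  refine SimpleGraph.exists_isHamiltonianCycle_of_orbits (kneserGraph (triangulations n))
    (rotateTriangulation h2)
    (fun T => kneserGraph_adj_of_disjoint hn (disjoint_rotateTriangulation h2 T)) ?_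
    (fun S T => ∃ v w, IsMaxFlip S.1 T.1 v w) ?_ ?_ (fun T => maxChordDegree T.1) ?_
    ⟨fanZero hn, fanZero_mem_triangulations hn⟩ (rotate_rotate_fanZero_ne hn h2) ?_ ?_ ?_
  · intro S T h
    exact kneserGraph_adj_of_disjoint hn ((Finset.disjoint_image rotateChord_injective).2 h.2)
  · rintro S T ⟨v, w, h1, h3⟩
    refine ⟨v + 1, w + 1, (isFlip_rotateTriangulation h2).2 h1, ?_⟩
    rw [coe_rotateTriangulation, chordDegree_image_rotateChord, maxChordDegree_image_rotateChord,
      h3]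
  · rintro S T ⟨v, w, h, -⟩
    rcases h.disjoint_or_disjoint hn h2 with h | h
    · exact ⟨_, _, Equiv.Perm.sameCycle_apply_right.2 (Equiv.Perm.SameCycle.refl _ _),
        Equiv.Perm.SameCycle.refl _ _, kneserGraph_adj_of_disjoint hn h⟩
    · exact ⟨_, _, Equiv.Perm.SameCycle.refl _ _,
        Equiv.Perm.sameCycle_apply_right.2 (Equiv.Perm.SameCycle.refl _ _),
        kneserGraph_adj_of_disjoint hn h⟩
  · rintro S T ⟨v, w, h⟩
    exact h.maxChordDegree_lt S.2
  · intro T hT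
    obtain ⟨v, hv⟩ := exists_chordDegree_eq_maxChordDegree T.1
    -- If no diagonal at `v` is missing, `T` is a fan and lies in the root orbit.
    obtain ⟨T', w, h⟩ := exists_isFlip hn v T (by
      by_contra hno
      push Not at hno
      exact hT (sameCycle_fanZero hn h2 v T hno))
    exact ⟨T', v, w, h, hv⟩
  · rintro S T ⟨v, w, h⟩
    exact h.rotate_rotate_ne hn h2
  · rintro S T ⟨v, w, h⟩
    exact h.ncard_add_one_le hn h2
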